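/- Let $F$ be an algebraically closed field of characteristic $0$. For $t\in F$ let $D_t=(Fe+Ff)\oplus(Fu+Fv)$ be the Jordan superalgebra with even part $Fe+Ff$, odd part $Fu+Fv$, and supercommutative product $e^2=e$, $f^2=f$, $e\cdot f=0$, $e\cdot u=f\cdot u=\tfrac12u$, $e\cdot v=f\cdot v=\tfrac12v$, $u\cdot v=e+tf$. For a superspace $V=V_{\bar 0}\oplus V_{\bar 1}$ let $\mathrm{End}_F(V)^+$ be the Jordan superalgebra with product $a\circ b=\tfrac12(ab+(-1)^{|a||b|}ba)$ for homogeneous $a,b$. For a natural number $m$ let $V(m)$ be the superspace with basis $e_0,\dots,e_{2m}$, where $e_k$ has the parity of $k$, with operators $\rho_y e_k=e_{k+1}$ ($e_{2m+1}=0$), $\rho_x e_{2i}=-i\,e_{2i-1}$ and $\rho_x e_{2i+1}=(m-i)e_{2i}$ (the irreducible $\mathfrak{osp}(1,2)$-module of highest weight $m$). Up to scalars $V(m)$ has a unique nonzero even bilinear form $(\cdot\mid\cdot)$ such that $(zv\mid w)=(-1)^{|v|}(v\mid zw)$ for homogeneous $v,w$ and $z=\rho_x,\rho_y$. Let $V(m)^{op}$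 be $V(m)$ with the parities exchanged and with the form $(v\mid w)'=(-1)^{|v|}(v\mid w)$, where $|v|$ is the parity in $V(m)$. If $t\neq\pm1$, let $D_t$ act on $V(m)$ and on $V(m)^{op}$ by $$e\mapsto\tfrac1{t-1}\bigl(t\,\mathrm{id}+(1+t)(\rho_x\rho_y-\rho_y\rho_x)\bigr),\quad f\mapsto\tfrac1{1-t}\bigl(\mathrm{id}+(1+t)(\rho_x\rho_y-\rho_y\rho_x)\bigr),\quad u\mapsto2\rho_x,\quad v\mapsto-(1+t)\rho_y.$$ The superinvolution $*$ of $\mathrm{End}_F(W)$ associated to a nondegenerate supersymmetric bilinear superform on $W$ is given by $(gv,w)=(-1)^{|g||v|}(v,g^*w)$ for homogeneous $g,v$, and $H(\mathrm{End}_F(W),*)=\{g: g^*=g\}$. **Proposition.** Let $V\ne0$ be a finite dimensional superspace over $F$, let $t\in F$ with $t\neq0,\pm1$, and let $B$ be a unital (graded) subalgebra of $\mathrm{End}_F(V)^+$ that generates $\mathrm{End}_F(V)$ as an associative algebra, with an isomorphism of superalgebras $\psi:D_t\to B$. Then there is a natural number $m\ge1$ with $t=-\frac{m}{m+1}$ or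 $t=-\frac{m+1}{m}$, and one of the following holds. 1. $m$ is even, the form $(\cdot\mid\cdot)$ on $V(m)$ is a nondegenerate supersymmetric bilinear superform, and there is a homogeneous (even or odd) linear bijection $\varphi:V\to V(m)$ with $\varphi(\psi(a)v)=a\,\varphi(v)$ for $a\in D_t$, $v\in V$, such that $\varphi B\varphi^{-1}\subseteq H(\mathrm{End}_F(V(m)),*)$, where $*$ is the superinvolution associated to $(\cdot\mid\cdot)$. 2. $m$ is odd, the form $(\cdot\mid\cdot)'$ on $V(m)^{op}$ is a nondegenerate supersymmetric bilinear superform, and there is a homogeneous (even or odd) linear bijection $\varphi:V\to V(m)^{op}$ with $\varphi(\psi(a)v)=a\,\varphi(v)$ for $a\in D_t$, $v\in V$, such that $\varphi B\varphi^{-1}\subseteq H(\mathrm{End}_F(V(m)^{op}),\diamond)$, where $\diamond$ is the superinvolution associated to $(\cdot\mid\cdot)'$. -/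

import Mathlib

/-- The sign `(-1)^i` of a parity `i`, as a scalar. -/
def superSign (F : Type*) [Field F] (i : ZMod 2) : F := (-1) ^ i.val

/-! ### Endomorphisms of a superspace -/

section EndGrading

variable {F V : Type*} [Field F] [AddCommGroup V] [Module F V]

/-- The parity grading of `End_F(V)` for a superspace `V = V₀ ⊕ V₁`: the endomorphisms of
degree `i` are those that map `V_j` into `V_{i+j}`. -/
def endGrading (𝒱 : ZMod 2 → Submodule F V) (i : ZMod 2) :
    Submodule F (Module.End F V) where
  carrier := {f | ∀ j, ∀ v ∈ 𝒱 j, f v ∈ 𝒱 (i + j)}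
  add_mem' := fun hf hg j v hv => (𝒱 (i + j)).add_mem (hf j v hv) (hg j v hv)
  zero_mem' := fun j _ _ => (𝒱 (i + j)).zero_mem
  smul_mem' := fun c _ hf j v hv => (𝒱 (i + j)).smul_mem c (hf j v hv)

/-- The projection of a superspace onto its component of parity `i`. -/
def parityProj (𝒱 : ZMod 2 → Submodule F V) [DirectSum.Decomposition 𝒱] (i : ZMod 2) :
    Module.End F V :=
  (𝒱 i).subtype ∘ₗ DirectSum.component F (ZMod 2) (fun i => 𝒱 i) i ∘ₗ
    (DirectSum.decomposeLinearEquiv 𝒱).toLinearMap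

theorem parityProj_apply (𝒱 : ZMod 2 → Submodule F V) [DirectSum.Decomposition 𝒱]
    (i : ZMod 2) (v : V) : parityProj 𝒱 i v = DirectSum.decompose 𝒱 v i := rfl

/-- The homogeneous component of degree `i` of an endomorphism. -/
def endComponent (𝒱 : ZMod 2 → Submodule F V) [DirectSum.Decomposition 𝒱] (i : ZMod 2)
    (f : Module.End F V) : Module.End F V :=
  ∑ j : ZMod 2, parityProj 𝒱 (i + j) * f * parityProj 𝒱 j

theorem endComponent_apply_of_mem (𝒱 : ZMod 2 → Submodule F V) [DirectSum.Decomposition 𝒱]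
    (i : ZMod 2) (f : Module.End F V) {j : ZMod 2} {v : V} (hv : v ∈ 𝒱 j) :
    endComponent 𝒱 i f v = DirectSum.decompose 𝒱 (f v) (i + j) := by
  rw [endComponent, LinearMap.sum_apply, Finset.sum_eq_single j]
  · simp [Module.End.mul_apply, parityProj_apply, DirectSum.decompose_of_mem_same 𝒱 hv]
  · intro k _ hk
    simp [Module.End.mul_apply, parityProj_apply, DirectSum.decompose_of_mem_ne 𝒱 hv hk.symm]
  · simp

theorem endComponent_mem (𝒱 : ZMod 2 → Submodule F V) [DirectSum.Decomposition 𝒱]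
    (i : ZMod 2) (f : Module.End F V) : endComponent 𝒱 i f ∈ endGrading 𝒱 i := by
  intro j v hv
  rw [endComponent_apply_of_mem 𝒱 i f hv]
  exact SetLike.coe_mem _

/-- Two endomorphisms that agree on homogeneous vectors are equal. -/
theorem end_ext_homogeneous (𝒱 : ZMod 2 → Submodule F V) [DirectSum.Decomposition 𝒱]
    {f g : Module.End F V} (h : ∀ j, ∀ v ∈ 𝒱 j, f v = g v) : f = g := by
  ext v
  induction v using DirectSum.Decomposition.inductionOn 𝒱 with
  | zero => simp
  | homogeneous v => exact h _ _ v.2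
  | add v w hv hw => simp [hv, hw]

theorem sum_endComponent (𝒱 : ZMod 2 → Submodule F V) [DirectSum.Decomposition 𝒱]
    (f : Module.End F V) : ∑ i : ZMod 2, endComponent 𝒱 i f = f := by
  refine end_ext_homogeneous 𝒱 fun j v hv => ?_
  rw [LinearMap.sum_apply]
  simp only [endComponent_apply_of_mem 𝒱 _ f hv]
  rw [Fintype.sum_equiv (Equiv.addRight j) (fun i => (DirectSum.decompose 𝒱 (f v) (i + j) : V))
    (fun i => (DirectSum.decompose 𝒱 (f v) i : V)) (fun _ => rfl)]
  classical
  conv_rhs => rw [← DirectSum.sum_support_decompose 𝒱 (f v)]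
  symm
  apply Finset.sum_subset (Finset.subset_univ _)
  intro i _ hi
  simpa using hi

theorem endComponent_of_mem_same (𝒱 : ZMod 2 → Submodule F V) [DirectSum.Decomposition 𝒱]
    {i : ZMod 2} {f : Module.End F V} (hf : f ∈ endGrading 𝒱 i) : endComponent 𝒱 i f = f := by
  refine end_ext_homogeneous 𝒱 fun j v hv => ?_
  rw [endComponent_apply_of_mem 𝒱 i f hv, DirectSum.decompose_of_mem_same 𝒱 (hf j v hv)]

theorem endComponent_of_mem_ne (𝒱 : ZMod 2 → Submodule F V) [DirectSum.Decomposition 𝒱]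
    {i k : ZMod 2} {f : Module.End F V} (hf : f ∈ endGrading 𝒱 i) (h : i ≠ k) :
    endComponent 𝒱 k f = 0 := by
  refine end_ext_homogeneous 𝒱 fun j v hv => ?_
  rw [endComponent_apply_of_mem 𝒱 k f hv,
    DirectSum.decompose_of_mem_ne 𝒱 (hf j v hv) (fun e => h (add_right_cancel e))]
  rfl

theorem endComponent_add (𝒱 : ZMod 2 → Submodule F V) [DirectSum.Decomposition 𝒱]
    (i : ZMod 2) (f g : Module.End F V) :
    endComponent 𝒱 i (f + g) = endComponent 𝒱 i f + endComponent 𝒱 i g := by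
  simp [endComponent, mul_add, add_mul, Finset.sum_add_distrib]

/-- `End_F(V)` is an associative superalgebra. -/
noncomputable instance endGradedAlgebra (𝒱 : ZMod 2 → Submodule F V)
    [DirectSum.Decomposition 𝒱] : GradedAlgebra (endGrading 𝒱) where
  one_mem := fun j v hv => by simpa using hv
  mul_mem := fun i k f g hf hg j v hv => by
    rw [Module.End.mul_apply, add_assoc]
    exact hf _ _ (hg _ _ hv)
  decompose' := fun f =>
    ∑ i : ZMod 2, DirectSum.of (fun i => endGrading 𝒱 i) i ⟨endComponent 𝒱 i f,
      endComponent_mem 𝒱 i f⟩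
  left_inv := fun f => by
    rw [map_sum]
    simpa using sum_endComponent 𝒱 f
  right_inv := fun x => by
    induction x using DirectSum.induction_on with
    | zero =>
      refine Finset.sum_eq_zero fun i _ => ?_
      have : (⟨endComponent 𝒱 i 0, endComponent_mem 𝒱 i 0⟩ : endGrading 𝒱 i) = 0 :=
        Subtype.ext (by simp [endComponent])
      simp [this]
    | of i x =>
      simp only [DirectSum.coeAddMonoidHom_of]
      rw [Finset.sum_eq_single i]
      · congr 1
        exact Subtype.ext (endComponent_of_mem_same 𝒱 x.2)
      · intro k _ hk
        have : (⟨endComponent 𝒱 k x, endComponent_mem 𝒱 k x⟩ : endGrading 𝒱 k) = 0 :=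
          Subtype.ext (endComponent_of_mem_ne 𝒱 x.2 hk.symm)
        simp [this]
      · simp
    | add x y hx hy =>
      rw [map_add]
      conv_rhs => rw [← hx, ← hy]
      rw [← Finset.sum_add_distrib]
      refine Finset.sum_congr rfl fun i _ => ?_
      refine Eq.trans ?_ (map_add (DirectSum.of (fun i => endGrading 𝒱 i) i) _ _)
      refine congrArg (DirectSum.of (fun i => endGrading 𝒱 i) i) ?_
      apply Subtype.ext
      simp only [Submodule.coe_add, endComponent_add]

end EndGrading

/-! ### Associative superalgebras and their Jordan superalgebras -/

section Jordan

variable {F A : Type*} [Field F] [Ring A] [Algebra F A]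

/-- The product `a ∘ b = ½ (ab + (-1)^{|a||b|} ba)` of the Jordan superalgebra `A⁺`, extended
bilinearly from homogeneous elements. -/
noncomputable def jordanMul (𝒜 : ZMod 2 → Submodule F A) [GradedAlgebra 𝒜] (a b : A) : A :=
  (2⁻¹ : F) • ∑ i : ZMod 2, ∑ j : ZMod 2,
    ((DirectSum.decompose 𝒜 a i : A) * (DirectSum.decompose 𝒜 b j : A) +
      superSign F (i * j) • ((DirectSum.decompose 𝒜 b j : A) * (DirectSum.decompose 𝒜 a i : A)))

/-- `B` is a unital (graded) subalgebra of the Jordan superalgebra `A⁺`. -/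
structure IsUnitalJordanSubalgebra (𝒜 : ZMod 2 → Submodule F A) [GradedAlgebra 𝒜]
    (B : Submodule F A) : Prop where
  graded : ∀ a ∈ B, ∀ i : ZMod 2, (DirectSum.decompose 𝒜 a i : A) ∈ B
  mul_mem : ∀ a ∈ B, ∀ b ∈ B, jordanMul 𝒜 a b ∈ B
  one_mem : (1 : A) ∈ B

/-- A superinvolution of an associative superalgebra: a graded linear map with `x** = x` and
`(xy)* = (-1)^{|x||y|} y* x*` for homogeneous `x`, `y`. -/
structure IsSuperinvolution (𝒜 : ZMod 2 → Submodule F A) (star : A →ₗ[F] A) : Prop where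
  graded : ∀ i, ∀ a ∈ 𝒜 i, star a ∈ 𝒜 i
  involutive : ∀ a, star (star a) = a
  map_mul : ∀ i j, ∀ a ∈ 𝒜 i, ∀ b ∈ 𝒜 j,
    star (a * b) = superSign F (i * j) • (star b * star a)

/-- The space `H(A, *)` of hermitian elements. -/
def hermitianPart (star : A →ₗ[F] A) : Submodule F A :=
  LinearMap.eqLocus star LinearMap.id

end Jordan

/-! ### The Jordan superalgebra `D_t` -/

/-- The four-dimensional Jordan superalgebra `D_t`; the coordinates `0, 1, 2, 3` are those with
respect to the basis `e, f` (even), `u, v` (odd). -/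
def KacD (F : Type*) [Field F] (_t : F) : Type _ := Fin 4 → F

namespace KacD

variable (F : Type*) [Field F] (t : F)

instance : AddCommGroup (KacD F t) := inferInstanceAs (AddCommGroup (Fin 4 → F))

instance : Module F (KacD F t) := inferInstanceAs (Module F (Fin 4 → F))

/-- The supercommutative product with `e² = e`, `f² = f`, `e·f = 0`, `e·u = f·u = ½ u`,
`e·v = f·v = ½ v`, `u·v = e + t f`. -/
instance : Mul (KacD F t) where
  mul a b := ![a 0 * b 0 + (a 2 * b 3 - a 3 * b 2),
    a 1 * b 1 + t * (a 2 * b 3 - a 3 * b 2),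
    2⁻¹ * ((a 0 + a 1) * b 2 + (b 0 + b 1) * a 2),
    2⁻¹ * ((a 0 + a 1) * b 3 + (b 0 + b 1) * a 3)]

/-- The parity grading of `D_t`: even part `F e + F f`, odd part `F u + F v`. -/
def grading (i : ZMod 2) : Submodule F (KacD F t) :=
  Submodule.span F (if i = 0 then {![1, 0, 0, 0], ![0, 1, 0, 0]}
    else {![0, 0, 1, 0], ![0, 0, 0, 1]} : Set (Fin 4 → F))

end KacD

/-- `ψ` is an isomorphism of superalgebras from `D_t` onto the subalgebra `B` of `A⁺`. -/
structure IsKacDIso {F A : Type*} [Field F] [Ring A] [Algebra F A]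
    (𝒜 : ZMod 2 → Submodule F A) [GradedAlgebra 𝒜] (B : Submodule F A) (t : F)
    (ψ : KacD F t ≃ₗ[F] B) : Prop where
  graded : ∀ i, ∀ a ∈ KacD.grading F t i, (ψ a : A) ∈ 𝒜 i
  map_mul : ∀ a b, (ψ (a * b) : A) = jordanMul 𝒜 (ψ a : A) (ψ b : A)

/-! ### Superforms -/

section Superform

variable {F W : Type*} [Field F] [AddCommGroup W] [Module F W]

/-- The superspace `W^op` obtained from `W` by exchanging the parities. -/
def opGrading (𝒲 : ZMod 2 → Submodule F W) : ZMod 2 → Submodule F W := fun i => 𝒲 (i + 1)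

/-- A linear bijection of superspaces that is homogeneous, that is, even or odd. -/
def IsHomogeneousEquiv {V : Type*} [AddCommGroup V] [Module F V]
    (𝒱 : ZMod 2 → Submodule F V) (𝒲 : ZMod 2 → Submodule F W) (φ : V ≃ₗ[F] W) : Prop :=
  ∃ ε : ZMod 2, ∀ i, ∀ v ∈ 𝒱 i, φ v ∈ 𝒲 (i + ε)

/-- A nondegenerate supersymmetric bilinear superform: `W₀` and `W₁` are orthogonal, and the form
is symmetric on `W₀` and skewsymmetric on `W₁`. -/
structure IsSuperform (𝒲 : ZMod 2 → Submodule F W) (b : LinearMap.BilinForm F W) : Prop where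
  nondegenerate : b.Nondegenerate
  orthogonal : ∀ i j, i ≠ j → ∀ v ∈ 𝒲 i, ∀ w ∈ 𝒲 j, b v w = 0
  symm_even : ∀ v ∈ 𝒲 0, ∀ w ∈ 𝒲 0, b v w = b w v
  skew_odd : ∀ v ∈ 𝒲 1, ∀ w ∈ 𝒲 1, b v w = -b w v

/-- `star` is the superinvolution of `End_F(W)` associated to the form `b`:
`(f v, w) = (-1)^{|f||v|} (v, f* w)` for homogeneous `f`, `v`. -/
structure IsAssociatedSuperinvolution (𝒲 : ZMod 2 → Submodule F W)
    (b : LinearMap.BilinForm F W) (star : Module.End F W →ₗ[F] Module.End F W) : Prop where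
  superinvolution : IsSuperinvolution (endGrading 𝒲) star
  adjoint : ∀ i j, ∀ f ∈ endGrading 𝒲 i, ∀ v ∈ 𝒲 j, ∀ w,
    b (f v) w = superSign F (i * j) * b v (star f w)

end Superform

/-! ### The `osp(1,2)`-modules `V(m)` -/

/-- The space `V(m)`, with basis `e_0, …, e_{2m}`. -/
abbrev OspV (F : Type*) (m : ℕ) : Type _ := Fin (2 * m + 1) → F

namespace OspV

variable (F : Type*) [Field F] (m : ℕ)

/-- The basis vector `e_k`, with `e_k = 0` for `k > 2m`. -/
def e (k : ℕ) : OspV F m := fun i => if (i : ℕ) = k then 1 else 0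

/-- `V(m)_i` is spanned by the `e_k` with `k` of parity `i`. -/
def grading (i : ZMod 2) : Submodule F (OspV F m) :=
  Submodule.span F {w | ∃ k : ℕ, (k : ZMod 2) = i ∧ w = e F m k}

/-- The action of `x`: `x e_{2i} = -i e_{2i-1}` and `x e_{2i+1} = (m - i) e_{2i}`. -/
noncomputable def rhoX : Module.End F (OspV F m) :=
  (Pi.basisFun F (Fin (2 * m + 1))).constr F fun k =>
    (if Even (k : ℕ) then -(((k : ℕ) / 2 : ℕ) : F) else (m : F) - (((k : ℕ) / 2 : ℕ) : F)) •
      e F m ((k : ℕ) - 1)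

/-- The action of `y`: `y e_k = e_{k+1}`, and `y e_{2m} = 0`. -/
noncomputable def rhoY : Module.End F (OspV F m) :=
  (Pi.basisFun F (Fin (2 * m + 1))).constr F fun k => e F m ((k : ℕ) + 1)

/-- The operator by which an element of `D_t` acts on `V(m)`:
`e ↦ (t-1)⁻¹ (t id + (1+t)(xy - yx))`, `f ↦ (1-t)⁻¹ (id + (1+t)(xy - yx))`, `u ↦ 2x`,
`v ↦ -(1+t) y`. -/
noncomputable def dAction (t : F) (a : KacD F t) : Module.End F (OspV F m) :=
  a 0 • (t - 1)⁻¹ • (t • 1 + (1 + t) • (rhoX F m * rhoY F m - rhoY F m * rhoX F m)) +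
  a 1 • (1 - t)⁻¹ • (1 + (1 + t) • (rhoX F m * rhoY F m - rhoY F m * rhoX F m)) +
  a 2 • (2 : F) • rhoX F m +
  a 3 • (-(1 + t)) • rhoY F m

/-- `z` is supersymmetric for `b`: `(z v | w) = (-1)^{|v|} (v | z w)` for homogeneous `v`, `w`. -/
def IsSupersymmetricOp (b : LinearMap.BilinForm F (OspV F m)) (z : Module.End F (OspV F m)) :
    Prop :=
  ∀ i j, ∀ v ∈ grading F m i, ∀ w ∈ grading F m j, b (z v) w = superSign F i * b v (z w)

/-- `b` is a nonzero even bilinear form on `V(m)` for which `x` and `y` act by supersymmetric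
operators. -/
structure IsInvariantForm (b : LinearMap.BilinForm F (OspV F m)) : Prop where
  ne_zero : b ≠ 0
  even : ∀ i j, i ≠ j → ∀ v ∈ grading F m i, ∀ w ∈ grading F m j, b v w = 0
  supersymm_x : IsSupersymmetricOp F m b (rhoX F m)
  supersymm_y : IsSupersymmetricOp F m b (rhoY F m)

/-- The form `(v | w)' = (-1)^{|v|} (v | w)` on `V(m)^op`, where `|v|` is the parity in `V(m)`:
the coordinate `v_k` is multiplied by `(-1)^k`. -/
noncomputable def opForm (b : LinearMap.BilinForm F (OspV F m)) :
    LinearMap.BilinForm F (OspV F m) :=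
  b ∘ₗ (Pi.basisFun F (Fin (2 * m + 1))).constr F fun k => (-1 : F) ^ (k : ℕ) • e F m k

/-- The form with `(e_{2r} | e_{2(m-r)}) = (e_{2r+1} | e_{2(m-r)-1}) = (-1)^r` and all other
products of basis vectors zero. -/
noncomputable def superForm : LinearMap.BilinForm F (OspV F m) :=
  Matrix.toBilin' (Matrix.of fun i j : Fin (2 * m + 1) =>
    if (i : ℕ) + (j : ℕ) = 2 * m then (-1 : F) ^ ((i : ℕ) / 2) else 0)

theorem rhoX_e {k : ℕ} (hk : k < 2 * m + 1) : rhoX F m (e F m k) =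
    (if Even k then -((k / 2 : ℕ) : F) else (m : F) - ((k / 2 : ℕ) : F)) • e F m (k - 1) := by
  have : e F m k = Pi.basisFun F (Fin (2 * m + 1)) ⟨k, hk⟩ := by
    ext i; simp [e, Pi.single_apply, Fin.ext_iff]
  rw [this, rhoX, Module.Basis.constr_basis]

theorem rhoY_e {k : ℕ} (hk : k < 2 * m + 1) : rhoY F m (e F m k) = e F m (k + 1) := by
  have : e F m k = Pi.basisFun F (Fin (2 * m + 1)) ⟨k, hk⟩ := by
    ext i; simp [e, Pi.single_apply, Fin.ext_iff]
  rw [this, rhoY, Module.Basis.constr_basis]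

theorem e_eq_zero {k : ℕ} (hk : 2 * m < k) : e F m k = 0 := by
  ext i
  have := i.2
  simp only [e, Pi.zero_apply, ite_eq_right_iff]
  omega

theorem superForm_e (j k : ℕ) : superForm F m (e F m j) (e F m k) =
    if j + k = 2 * m then (-1 : F) ^ (j / 2) else 0 := by
  by_cases hj : j < 2 * m + 1
  · by_cases hk : k < 2 * m + 1
    · have h1 : e F m j = Pi.single (⟨j, hj⟩ : Fin (2 * m + 1)) 1 := by
        ext i; simp [e, Pi.single_apply, Fin.ext_iff]
      have h2 : e F m k = Pi.single (⟨k, hk⟩ : Fin (2 * m + 1)) 1 := by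
        ext i; simp [e, Pi.single_apply, Fin.ext_iff]
      rw [h1, h2, superForm, Matrix.toBilin'_single]
      rfl
    · rw [e_eq_zero F m (k := k) (by omega), map_zero, if_neg (by omega)]
  · rw [e_eq_zero F m (k := j) (by omega), map_zero, LinearMap.zero_apply, if_neg (by omega)]

theorem superSign_natCast (k : ℕ) : superSign F (k : ZMod 2) = (-1) ^ k := by
  rw [superSign, ZMod.val_natCast, ← neg_one_pow_eq_pow_mod_two]

/-- Supersymmetry of an operator can be checked on the basis vectors. -/
theorem isSupersymmetricOp_of_e {b : LinearMap.BilinForm F (OspV F m)}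
    {z : Module.End F (OspV F m)}
    (h : ∀ j k : ℕ, b (z (e F m j)) (e F m k) = (-1) ^ j * b (e F m j) (z (e F m k))) :
    IsSupersymmetricOp F m b z := by
  intro i j v hv w hw
  refine Submodule.span_induction₂
    (p := fun v w _ _ => b (z v) w = superSign F i * b v (z w)) ?_ ?_ ?_ ?_ ?_ ?_ ?_ hv hw
  · rintro _ _ ⟨k, hk, rfl⟩ ⟨l, -, rfl⟩
    rw [h, ← hk, superSign_natCast]
  · intros; simp
  · intros; simp
  · intro x y z' _ _ _ h1 h2; simp only [map_add, LinearMap.add_apply, h1, h2]; ring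
  · intro x y z' _ _ _ h1 h2; simp only [map_add, h1, h2]; ring
  · intro r x y _ _ h1; simp only [map_smul, LinearMap.smul_apply, h1, smul_eq_mul]; ring
  · intro r x y _ _ h1; simp only [map_smul, h1, smul_eq_mul]; ring

theorem isInvariantForm_superForm : IsInvariantForm F m (superForm F m) where
  ne_zero := fun h => by
    have h1 := superForm_e F m 0 (2 * m)
    rw [h] at h1
    simp at h1
  even := by
    intro i j hij v hv w hw
    refine Submodule.span_induction₂ (p := fun v w _ _ => superForm F m v w = 0)
      ?_ ?_ ?_ ?_ ?_ ?_ ?_ hv hw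
    · rintro _ _ ⟨k, hk, rfl⟩ ⟨l, hl, rfl⟩
      rw [superForm_e, if_neg]
      intro h
      apply hij
      have h2 : ((k + l : ℕ) : ZMod 2) = ((2 * m : ℕ) : ZMod 2) := by rw [h]
      have h3 : (2 : ZMod 2) = 0 := rfl
      push_cast at h2
      rw [hk, hl, h3, zero_mul] at h2
      rw [eq_neg_of_add_eq_zero_left h2, ZMod.neg_eq_self_mod_two]
    · intros; simp
    · intros; simp
    · intro x y z _ _ _ h1 h2; simp [h1, h2]
    · intro x y z _ _ _ h1 h2; simp [h1, h2]
    · intro r x y _ _ h1; simp [h1]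
    · intro r x y _ _ h1; simp [h1]
  supersymm_x := isSupersymmetricOp_of_e F m fun j k => by
    by_cases hj : j < 2 * m + 1
    swap
    · simp [e_eq_zero F m (k := j) (by omega)]
    by_cases hk : k < 2 * m + 1
    swap
    · simp [e_eq_zero F m (k := k) (by omega)]
    rw [rhoX_e F m hj, rhoX_e F m hk, map_smul, map_smul, LinearMap.smul_apply, superForm_e,
      superForm_e]
    by_cases hjk : j + k = 2 * m + 1
    · rcases Nat.even_or_odd' j with ⟨a, rfl | rfl⟩
      · obtain ⟨c, rfl⟩ : ∃ c, m = a + c := ⟨m - a, by omega⟩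
        obtain rfl : k = 2 * c + 1 := by omega
        have e2 : (2 * c + 1) / 2 = c := by omega
        have e3 : 2 * a / 2 = a := by omega
        have p1 : Even (2 * a) := even_two_mul a
        have p2 : ¬ Even (2 * c + 1) := by simp
        have p3 : 2 * a + (2 * c + 1 - 1) = 2 * (a + c) := by omega
        rw [if_pos p1, if_neg p2, if_pos p3, e2, e3]
        rcases a with _ | a
        · simp
        · have e1 : (2 * (a + 1) - 1) / 2 = a := by omega
          have p4 : 2 * (a + 1) - 1 + (2 * c + 1) = 2 * (a + 1 + c) := by omega
          rw [if_pos p4, e1]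
          simp only [pow_succ, pow_mul, smul_eq_mul]
          push_cast
          ring
      · obtain ⟨c, rfl⟩ : ∃ c, m = a + c := ⟨m - a, by omega⟩
        obtain rfl : k = 2 * c := by omega
        have e2 : (2 * a + 1) / 2 = a := by omega
        have e1 : (2 * a + 1 - 1) / 2 = a := by omega
        have e3 : 2 * c / 2 = c := by omega
        have p1 : Even (2 * c) := even_two_mul c
        have p2 : ¬ Even (2 * a + 1) := by simp
        have p3 : 2 * a + 1 - 1 + 2 * c = 2 * (a + c) := by omega
        rw [if_neg p2, if_pos p1, if_pos p3, e1, e2, e3]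
        rcases c with _ | c
        · simp
        · have p4 : 2 * a + 1 + (2 * (c + 1) - 1) = 2 * (a + (c + 1)) := by omega
          rw [if_pos p4]
          simp only [pow_succ, pow_mul, smul_eq_mul]
          push_cast
          ring
    · have hl : (if Even j then -((j / 2 : ℕ) : F) else (m : F) - ((j / 2 : ℕ) : F)) •
          (if j - 1 + k = 2 * m then (-1 : F) ^ ((j - 1) / 2) else 0) = 0 := by
        rcases j with _ | j
        · simp
        · rw [if_neg (c := j + 1 - 1 + k = 2 * m) (by omega), smul_zero]
      have hr : (if Even k then -((k / 2 : ℕ) : F) else (m : F) - ((k / 2 : ℕ) : F)) •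
          (if j + (k - 1) = 2 * m then (-1 : F) ^ (j / 2) else 0) = 0 := by
        rcases k with _ | k
        · simp
        · rw [if_neg (c := j + (k + 1 - 1) = 2 * m) (by omega), smul_zero]
      rw [hl, hr, mul_zero]
  supersymm_y := isSupersymmetricOp_of_e F m fun j k => by
    by_cases hj : j < 2 * m + 1
    swap
    · simp [e_eq_zero F m (k := j) (by omega)]
    by_cases hk : k < 2 * m + 1
    swap
    · simp [e_eq_zero F m (k := k) (by omega)]
    rw [rhoY_e F m hj, rhoY_e F m hk, superForm_e, superForm_e]
    by_cases hjk : j + k + 1 = 2 * m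
    · rw [if_pos (by omega), if_pos (by omega)]
      rcases Nat.even_or_odd' j with ⟨a, rfl | rfl⟩
      · have e1 : (2 * a + 1) / 2 = a := by omega
        have e2 : 2 * a / 2 = a := by omega
        rw [e1, e2]; simp [pow_mul]
      · have e1 : (2 * a + 1 + 1) / 2 = a + 1 := by omega
        have e2 : (2 * a + 1) / 2 = a := by omega
        rw [e1, e2]; simp [pow_succ, pow_mul]
    · rw [if_neg (by omega), if_neg (by omega), mul_zero]

end OspV

/-! Since $B$ generates $\mathrm{End}_F(V)$, a nonzero subspace stable under the operators $E,U,Y$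
of $e,u,v$ is all of $V$. These satisfy $EU+UE=U$, $EY+YE=Y$ and $[U,Y]=2(t+(1-t)E)$, hence
$[U^2,Y]=2(1+t)U$. If $U$ were invertible, multiplying by $U^{-1}$ and taking traces would give
$0=2(1+t)\dim V$ (`IsKacDTriple.exists_ker`). So there is a homogeneous $w\neq0$ with $Uw=0$ and
$Ew=sw$, $s\in\{0,1\}$.

The vectors $Y^kw$ are eigenvectors of $UY+YU$ for distinct eigenvalues, and $UY^kw=c_kY^{k-1}w$
(`IsKacDTriple.U_pow`). If $n$ is least with $Y^nw=0$, then $c_n=0$. This forces $n=2m+1$ and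
$2(t+(1-t)s)=-2m(1+t)$, whose two cases $s=0,1$ are the two values of $t$. The chain spans a stable
subspace, so after rescaling $V$ is $V(m)$ up to a parity shift (`IsKacDTriple.exists_equiv`). As
$t\neq1$, the actions of $e,f$ are recovered from $[U,Y]$.

For the forms, invariance fixes $(\cdot\mid\cdot)$ up to a scalar
(`IsInvariantForm.exists_eq_smul`), and exchanging its arguments costs $(-1)^m(-1)^{|v|}$. Thus it
is supersymmetric for even $m$, and its twist is supersymmetric on $V(m)^{op}$ for odd $m$. Either
way $\rho_x,\rho_y$ are hermitian, and then so is $\rho_x\rho_y-\rho_y\rho_x$, hence every operator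
of $D_t$. -/

/-! ### Arithmetic of parity signs. -/

theorem zmod_two_cases (i : ZMod 2) : i = 0 ∨ i = 1 := by
  revert i; decide

@[simp]
theorem superSign_zero (F : Type*) [Field F] : superSign F 0 = 1 := by simp [superSign]

@[simp]
theorem superSign_one (F : Type*) [Field F] : superSign F 1 = -1 := by
  simp [superSign, ZMod.val_one]

theorem superSign_add (F : Type*) [Field F] (i j : ZMod 2) :
    superSign F (i + j) = superSign F i * superSign F j := by
  have h : (1 + 1 : ZMod 2) = 0 := rfl
  rcases zmod_two_cases i with rfl | rfl <;> rcases zmod_two_cases j with rfl | rfl <;> simp [h]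

theorem superSign_mul_self (F : Type*) [Field F] (i : ZMod 2) :
    superSign F i * superSign F i = 1 := by
  rcases zmod_two_cases i with rfl | rfl <;> simp

theorem superSign_ne_zero (F : Type*) [Field F] (i : ZMod 2) : superSign F i ≠ 0 :=
  left_ne_zero_of_mul_eq_one (superSign_mul_self F i)

/-! ### The superinvolution associated to a superform -/

section AssociatedSuperinvolution

variable {F W : Type*} [Field F] [AddCommGroup W] [Module F W]

/-- `S` is the parity operator of the superspace `W`: it acts by `(-1)^i` on `W_i`, and `W_i` is
the whole eigenspace. -/
structure IsParityOp (𝒲 : ZMod 2 → Submodule F W) (S : Module.End F W) : Prop where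
  mul_self : S * S = 1
  mem_iff : ∀ i w, w ∈ 𝒲 i ↔ S w = superSign F i • w

/-- A nondegenerate bilinear form has a linear adjoint map. -/
theorem exists_adjoint [FiniteDimensional F W] {b : LinearMap.BilinForm F W}
    (hb : b.Nondegenerate) : ∃ adj : Module.End F W →ₗ[F] Module.End F W,
      ∀ f v w, b (f v) w = b v (adj f w) := by
  have hb' : LinearMap.BilinForm.Nondegenerate (LinearMap.flip b) :=
    LinearMap.flip_nondegenerate.2 hb
  let D := LinearMap.BilinForm.toDual (LinearMap.flip b) hb'
  have hD : ∀ (l : Module.Dual F W) v, b v (D.symm l) = l v := fun l v => by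
    have := LinearMap.congr_fun (D.apply_symm_apply l) v
    exact this
  refine ⟨{ toFun := fun f => D.symm.toLinearMap ∘ₗ Module.Dual.transpose f ∘ₗ D.toLinearMap
            map_add' := fun f g => ?_
            map_smul' := fun c f => ?_ }, fun f v w => ?_⟩
  · ext w; simp
  · ext w; simp
  · change _ = b v (D.symm (Module.Dual.transpose f (D w)))
    rw [hD]
    rfl

namespace IsParityOp

variable {𝒲 : ZMod 2 → Submodule F W} {S : Module.End F W}

theorem apply_apply (hS : IsParityOp 𝒲 S) (w : W) : S (S w) = w :=
  LinearMap.congr_fun hS.mul_self w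

variable [CharZero F]

theorem exists_add (hS : IsParityOp 𝒲 S) (w : W) :
    ∃ w₀ ∈ 𝒲 0, ∃ w₁ ∈ 𝒲 1, w₀ + w₁ = w := by
  refine ⟨(2⁻¹ : F) • (w + S w), ?_, (2⁻¹ : F) • (w - S w), ?_, ?_⟩
  · rw [hS.mem_iff]; simp [hS.apply_apply, add_comm]
  · rw [hS.mem_iff]; simp [hS.apply_apply, ← smul_neg]
  · rw [← smul_add, add_add_sub_cancel, ← two_smul F w, smul_smul, inv_mul_cancel₀ two_ne_zero,
      one_smul]

theorem ext_homogeneous {M : Type*} [AddCommGroup M] [Module F M] (hS : IsParityOp 𝒲 S)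
    {f g : W →ₗ[F] M} (h : ∀ i, ∀ w ∈ 𝒲 i, f w = g w) : f = g := by
  ext w
  obtain ⟨w₀, h₀, w₁, h₁, rfl⟩ := hS.exists_add w
  rw [map_add, map_add, h _ _ h₀, h _ _ h₁]

/-- Parities are eigenvalues of $S$, so the degree of an operator is read off from whether it
commutes or anticommutes with $S$. This allows sign computations as operator identities, for $V(m)$
and $V(m)^{op}$ alike. -/
theorem mem_endGrading_iff (hS : IsParityOp 𝒲 S) (i : ZMod 2) (f : Module.End F W) :
    f ∈ endGrading 𝒲 i ↔ S * f = superSign F i • (f * S) := by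
  constructor
  · intro hf
    refine hS.ext_homogeneous fun j w hw => ?_
    have h1 := (hS.mem_iff _ _).1 (hf j w hw)
    have h2 := (hS.mem_iff _ _).1 hw
    simp [Module.End.mul_apply, h1, h2, superSign_add, smul_smul]
  · intro hf j w hw
    have h2 := (hS.mem_iff _ _).1 hw
    have h1 := LinearMap.congr_fun hf w
    rw [hS.mem_iff, superSign_add, ← smul_smul, ← map_smul, ← h2]
    exact h1

theorem form_comm {b : LinearMap.BilinForm F W} (hS : IsParityOp 𝒲 S)
    (hb : IsSuperform 𝒲 b) (v w : W) : b (S v) w = b v (S w) := by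
  have : b ∘ₗ S = b.compl₂ S := by
    refine hS.ext_homogeneous fun i v hv => hS.ext_homogeneous fun j w hw => ?_
    have h1 := (hS.mem_iff _ _).1 hv
    have h2 := (hS.mem_iff _ _).1 hw
    by_cases hij : i = j
    · subst hij; simp [h1, h2]
    · simp [h1, h2, hb.orthogonal i j hij v hv w hw]
  exact LinearMap.congr_fun₂ this v w

/-- Supersymmetry as a single identity: the sign depends only on the common parity of the arguments,
since different parities are orthogonal. -/
theorem form_swap {b : LinearMap.BilinForm F W} (hS : IsParityOp 𝒲 S)
    (hb : IsSuperform 𝒲 b) (v w : W) : b w v = b v (S w) := by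
  have : LinearMap.flip b = b.compl₂ S := by
    refine hS.ext_homogeneous fun i v hv => hS.ext_homogeneous fun j w hw => ?_
    have h2 := (hS.mem_iff _ _).1 hw
    by_cases hij : i = j
    · subst hij
      rcases zmod_two_cases i with rfl | rfl
      · simp [h2, hb.symm_even v hv w hw]
      · simp [h2, hb.skew_odd v hv w hw]
    · simp [h2, hb.orthogonal i j hij v hv w hw,
        hb.orthogonal j i (Ne.symm hij) w hw v hv]
  exact LinearMap.congr_fun₂ this v w

theorem eq_of_form_eq {b : LinearMap.BilinForm F W} (hS : IsParityOp 𝒲 S)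
    (hb : IsSuperform 𝒲 b) {f g : Module.End F W}
    (h : ∀ j, ∀ v ∈ 𝒲 j, ∀ w, b v (f w) = b v (g w)) : f = g := by
  ext w
  rw [← sub_eq_zero]
  refine hb.nondegenerate.2 _ fun v => ?_
  have : LinearMap.flip b (f w) = LinearMap.flip b (g w) :=
    hS.ext_homogeneous fun j v hv => h j v hv w
  rw [map_sub, sub_eq_zero]
  exact LinearMap.congr_fun this v

/-- A nondegenerate supersymmetric bilinear superform has an associated superinvolution. -/
theorem exists_associated [FiniteDimensional F W] {b : LinearMap.BilinForm F W}
    (hS : IsParityOp 𝒲 S) (hb : IsSuperform 𝒲 b) :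
    ∃ star, IsAssociatedSuperinvolution 𝒲 b star := by
  obtain ⟨adj, hadj⟩ := exists_adjoint hb.nondegenerate
  have hext : ∀ f g : Module.End F W, (∀ v w, b v (f w) = b v (g w)) → f = g :=
    fun f g h => hS.eq_of_form_eq hb fun j v _ w => h v w
  have hSa : adj S = S := hext _ _ fun v w => by rw [← hadj, hS.form_comm hb]
  have hmul : ∀ f g, adj (f * g) = adj g * adj f := fun f g => hext _ _ fun v w => by
    rw [← hadj, Module.End.mul_apply, hadj, hadj]; rfl
  -- The ordinary adjoint fails to be involutive exactly by conjugation with $S$; the sign in the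
  -- definition of `star` on odd operators repairs this.
  have hadj2 : ∀ f, adj (adj f) = S * f * S := fun f => hext _ _ fun v w => by
    rw [← hadj, hS.form_swap hb w, ← hS.form_comm hb, ← hadj, hS.form_swap hb v]
    rfl
  have hSS := hS.mul_self
  -- $\tfrac12(f\pm SfS)$ are the even and odd parts of $f$. The even part goes to its adjoint, the
  -- odd part to minus its adjoint times $S$: the factor $(-1)^{|v|}$ in the defining identity is
  -- $S$ acting on $v$, and moving $S$ past the odd adjoint gives the minus.
  let star : Module.End F W →ₗ[F] Module.End F W :=
    { toFun := fun f => (2⁻¹ : F) • (adj (f + S * f * S) - adj (f - S * f * S) * S)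
      map_add' := fun f g => by
        simp only [mul_add, add_mul, map_add, map_sub, sub_mul, ← smul_add]
        congr 1
        abel
      map_smul' := fun c f => by
        simp only [mul_smul_comm, smul_mul_assoc, ← smul_add, ← smul_sub, map_smul,
          RingHom.id_apply]
        rw [smul_comm] }
  have hconj : ∀ i, ∀ f ∈ endGrading 𝒲 i, S * f * S = superSign F i • f := fun i f hf => by
    rw [(hS.mem_endGrading_iff i f).1 hf, smul_mul_assoc, mul_assoc, hSS, mul_one]
  have half : ∀ f : Module.End F W, (2⁻¹ : F) • (f + f) = f := fun f => by
    rw [← two_smul F f, smul_smul, inv_mul_cancel₀ two_ne_zero, one_smul]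
  have star0 : ∀ f ∈ endGrading 𝒲 0, star f = adj f := fun f hf => by
    change (2⁻¹ : F) • (adj (f + S * f * S) - adj (f - S * f * S) * S) = _
    rw [hconj 0 f hf, superSign_zero, one_smul, sub_self, map_zero, zero_mul, sub_zero, map_add,
      half]
  have star1 : ∀ f ∈ endGrading 𝒲 1, star f = -(adj f * S) := fun f hf => by
    change (2⁻¹ : F) • (adj (f + S * f * S) - adj (f - S * f * S) * S) = _
    rw [hconj 1 f hf, superSign_one, neg_one_smul, add_neg_cancel, map_zero, sub_neg_eq_add,
      zero_sub, smul_neg, map_add, add_mul, half]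
  have hgr : ∀ i, ∀ f ∈ endGrading 𝒲 i, star f ∈ endGrading 𝒲 i := fun i f hf => by
    have h1 := congrArg adj ((hS.mem_endGrading_iff i f).1 hf)
    rw [map_smul, hmul, hmul, hSa] at h1
    rw [hS.mem_endGrading_iff]
    rcases zmod_two_cases i with rfl | rfl
    · rw [star0 f hf, h1, superSign_zero, one_smul, one_smul]
    · rw [superSign_one, neg_one_smul] at h1 ⊢
      rw [star1 f hf, mul_neg, neg_mul, ← mul_assoc, neg_neg, h1, neg_mul]
  have hadjoint : ∀ i j, ∀ f ∈ endGrading 𝒲 i, ∀ v ∈ 𝒲 j, ∀ w,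
      b (f v) w = superSign F (i * j) * b v (star f w) := fun i j f hf v hv w => by
    rcases zmod_two_cases i with rfl | rfl
    · rw [star0 f hf, hadj, zero_mul, superSign_zero, one_mul]
    · rw [star1 f hf, LinearMap.neg_apply, map_neg, Module.End.mul_apply, ← hadj,
        ← hS.form_comm hb, (hS.mem_iff _ _).1 (hf j v hv), superSign_add, map_smul,
        LinearMap.smul_apply, one_mul, superSign_one, smul_eq_mul, neg_one_mul, neg_mul, neg_neg,
        ← mul_assoc, superSign_mul_self, one_mul]
  refine ⟨star, ⟨hgr, fun f => ?_, fun i j f hf g hg => ?_⟩, hadjoint⟩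
  · have h : star ∘ₗ star = LinearMap.id := by
      have key : ∀ i, ∀ f ∈ endGrading 𝒲 i, star (star f) = f := fun i f hf => by
        rcases zmod_two_cases i with rfl | rfl
        · rw [star0 _ (hgr 0 f hf), star0 f hf, hadj2, hconj 0 f hf, superSign_zero, one_smul]
        · have h := hconj 1 f hf
          rw [superSign_one, neg_one_smul] at h
          rw [star1 _ (hgr 1 f hf), star1 f hf, map_neg, hmul, hSa, hadj2, h, mul_neg, neg_neg,
            h, neg_neg]
      ext1 f
      have h0 : (2⁻¹ : F) • (f + S * f * S) ∈ endGrading 𝒲 0 := by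
        rw [hS.mem_endGrading_iff, superSign_zero, one_smul, mul_smul_comm, smul_mul_assoc,
          mul_add, add_mul, mul_assoc, mul_assoc, mul_assoc, hSS, mul_one, ← mul_assoc, hSS,
          one_mul, add_comm]
      have h1 : (2⁻¹ : F) • (f - S * f * S) ∈ endGrading 𝒲 1 := by
        rw [hS.mem_endGrading_iff, superSign_one, neg_one_smul, mul_smul_comm, smul_mul_assoc,
          mul_sub, sub_mul, mul_assoc, mul_assoc, mul_assoc, hSS, mul_one, ← mul_assoc, hSS,
          one_mul, ← smul_neg, neg_sub]
      have h2 : f = (2⁻¹ : F) • (f + S * f * S) + (2⁻¹ : F) • (f - S * f * S) := by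
        rw [← smul_add, add_add_sub_cancel, half]
      rw [LinearMap.comp_apply, LinearMap.id_apply, h2, map_add, map_add, key 0 _ h0, key 1 _ h1]
    exact LinearMap.congr_fun h f
  · refine hS.eq_of_form_eq hb fun k v hv w => ?_
    have h1 := hadjoint (i + j) k (f * g)
      (fun l u hu => by rw [add_assoc]; exact hf _ _ (hg _ _ hu)) v hv w
    rw [Module.End.mul_apply, hadjoint i (j + k) f hf _ (hg k v hv), hadjoint j k g hg v hv] at h1
    rw [add_mul, mul_add, superSign_add, superSign_add] at h1
    refine mul_left_cancel₀ (mul_ne_zero (superSign_ne_zero F (i * k))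
      (superSign_ne_zero F (j * k))) ?_
    rw [← h1, LinearMap.smul_apply, map_smul, smul_eq_mul, Module.End.mul_apply]
    ring

end IsParityOp

end AssociatedSuperinvolution

/-! ### The superforms on `V(m)` and `V(m)^op` -/

theorem superSign_injective (F : Type*) [Field F] [CharZero F] :
    Function.Injective (superSign F) := by
  have h : (-1 : F) ≠ 1 := by norm_num
  intro i j hij
  rcases zmod_two_cases i with rfl | rfl <;> rcases zmod_two_cases j with rfl | rfl
  · rfl
  · exact absurd (by simpa using hij.symm) h
  · exact absurd (by simpa using hij) h
  · rfl

theorem mem_endGrading_opGrading {F W : Type*} [Field F] [AddCommGroup W] [Module F W]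
    {𝒲 : ZMod 2 → Submodule F W} {i : ZMod 2} {f : Module.End F W} (hf : f ∈ endGrading 𝒲 i) :
    f ∈ endGrading (opGrading 𝒲) i := fun j v hv => by
  have := hf (j + 1) v hv
  rwa [← add_assoc] at this

namespace OspV

variable (F : Type*) [Field F] (m : ℕ)

theorem basisFun_eq_e (k : Fin (2 * m + 1)) : Pi.basisFun F (Fin (2 * m + 1)) k = e F m k := by
  ext i; simp [e, Pi.single_apply, Fin.ext_iff]

variable {F m} in
theorem ext_e {M : Type*} [AddCommGroup M] [Module F M] {f g : OspV F m →ₗ[F] M}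
    (h : ∀ k < 2 * m + 1, f (e F m k) = g (e F m k)) : f = g :=
  (Pi.basisFun F (Fin (2 * m + 1))).ext fun k => by rw [basisFun_eq_e]; exact h k k.2

theorem sum_smul_e (v : OspV F m) : ∑ k : Fin (2 * m + 1), v k • e F m k = v := by
  simp_rw [← basisFun_eq_e]
  exact (Pi.basisFun F (Fin (2 * m + 1))).sum_repr v

/-- The parity operator `e_k ↦ (-1)^k e_k`. -/
noncomputable def parityOp : Module.End F (OspV F m) :=
  (Pi.basisFun F (Fin (2 * m + 1))).constr F fun k => (-1 : F) ^ (k : ℕ) • e F m k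

theorem parityOp_e (k : ℕ) : parityOp F m (e F m k) = (-1 : F) ^ k • e F m k := by
  by_cases hk : k < 2 * m + 1
  · rw [← basisFun_eq_e F m ⟨k, hk⟩, parityOp, Module.Basis.constr_basis, basisFun_eq_e]
  · rw [e_eq_zero F m (by omega), map_zero, smul_zero]

theorem parityOp_apply (v : OspV F m) (k : Fin (2 * m + 1)) :
    parityOp F m v k = (-1) ^ (k : ℕ) * v k := by
  have : (LinearMap.proj k).comp (parityOp F m) =
      ((-1 : F) ^ (k : ℕ)) • (LinearMap.proj k : OspV F m →ₗ[F] F) := by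
    refine ext_e fun l _ => ?_
    simp only [LinearMap.comp_apply, parityOp_e, LinearMap.proj_apply, LinearMap.smul_apply,
      Pi.smul_apply, smul_eq_mul, e]
    split_ifs with h
    · rw [h]
    · simp
  exact LinearMap.congr_fun this v

theorem e_mem_grading (k : ℕ) : e F m k ∈ grading F m k :=
  Submodule.subset_span ⟨k, rfl, rfl⟩

theorem isParityOp_parityOp [CharZero F] : IsParityOp (grading F m) (parityOp F m) where
  mul_self := ext_e fun k _ => by
    rw [Module.End.mul_apply, parityOp_e, map_smul, parityOp_e, smul_smul, ← pow_add,
      ← two_mul, pow_mul, neg_one_sq,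
      one_pow, one_smul]
    rfl
  mem_iff i w := by
    constructor
    · intro hw
      induction hw using Submodule.span_induction with
      | mem x hx => obtain ⟨k, rfl, rfl⟩ := hx; rw [parityOp_e, superSign_natCast]
      | zero => simp
      | add x y _ _ hx hy => rw [map_add, hx, hy, smul_add]
      | smul c x _ hx => rw [map_smul, hx, smul_comm]
    · intro hw
      rw [← sum_smul_e F m w]
      refine Submodule.sum_mem _ fun k _ => ?_
      have h1 := congrFun hw k
      rw [parityOp_apply, Pi.smul_apply, smul_eq_mul, ← superSign_natCast] at h1
      -- A nonzero coordinate forces $(-1)^k=(-1)^i$, and $-1\neq1$ in characteristic $0$, so $k$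
      -- has parity $i$.
      by_cases h0 : w k = 0
      · rw [h0, zero_smul]; exact Submodule.zero_mem _
      · have h2 := mul_right_cancel₀ h0 h1
        have h3 : ((k : ℕ) : ZMod 2) = i := superSign_injective F h2
        rw [← h3]
        exact Submodule.smul_mem _ _ (e_mem_grading F m k)

theorem isParityOp_neg_parityOp [CharZero F] :
    IsParityOp (opGrading (grading F m)) (-parityOp F m) where
  mul_self := LinearMap.ext fun v => by
    simp [(isParityOp_parityOp F m).apply_apply]
  mem_iff i w := by
    rw [opGrading, (isParityOp_parityOp F m).mem_iff, superSign_add, superSign_one, mul_neg_one,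
      neg_smul, LinearMap.neg_apply, neg_eq_iff_eq_neg]

theorem mem_endGrading_one_of_e {z : Module.End F (OspV F m)}
    (h : ∀ k < 2 * m + 1, z (e F m k) ∈ grading F m (1 + k)) :
    z ∈ endGrading (grading F m) 1 := by
  intro j v hv
  induction hv using Submodule.span_induction with
  | mem x hx =>
    obtain ⟨k, rfl, rfl⟩ := hx
    by_cases hk : k < 2 * m + 1
    · exact h k hk
    · rw [e_eq_zero F m (by omega), map_zero]; exact Submodule.zero_mem _
  | zero => rw [map_zero]; exact Submodule.zero_mem _
  | add x y _ _ hx hy => rw [map_add]; exact Submodule.add_mem _ hx hy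
  | smul c x _ hx => rw [map_smul]; exact Submodule.smul_mem _ _ hx

theorem rhoY_mem : rhoY F m ∈ endGrading (grading F m) 1 :=
  mem_endGrading_one_of_e F m fun k hk => by
    have h : (1 + (k : ZMod 2)) = (k + 1 : ℕ) := by push_cast; exact add_comm _ _
    rw [rhoY_e F m hk, h]
    exact e_mem_grading F m _

theorem rhoX_mem : rhoX F m ∈ endGrading (grading F m) 1 :=
  mem_endGrading_one_of_e F m fun k hk => by
    rw [rhoX_e F m hk]
    rcases k with _ | k
    · simp
    · refine Submodule.smul_mem _ _ ?_
      have : (1 + ((k + 1 : ℕ) : ZMod 2)) = (k : ℕ) := by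
        have h : (1 + 1 : ZMod 2) = 0 := rfl
        push_cast
        rw [add_comm, add_assoc, h, add_zero]
      rw [this]
      exact e_mem_grading F m k

/-- For $j+k=2m$, the coefficients $(-1)^{\lfloor j/2\rfloor}$ and $(-1)^{\lfloor k/2\rfloor}$ have
product $(-1)^m$ when $j$ is even and $(-1)^{m-1}$ when $j$ is odd. -/
theorem superForm_swap (v w : OspV F m) :
    superForm F m v w = (-1) ^ m * superForm F m w (parityOp F m v) := by
  have : superForm F m =
      ((-1 : F) ^ m) • (LinearMap.flip (superForm F m)).comp (parityOp F m) := by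
    refine ext_e fun j _ => ext_e fun k _ => ?_
    simp only [LinearMap.smul_apply, LinearMap.comp_apply, LinearMap.flip_apply, parityOp_e,
      map_smul, superForm_e, smul_eq_mul, add_comm k j]
    split_ifs with h
    · rcases Nat.even_or_odd' j with ⟨r, rfl | rfl⟩
      · obtain ⟨c, rfl⟩ : ∃ c, m = r + c := ⟨m - r, by omega⟩
        obtain rfl : k = 2 * c := by omega
        have e1 : 2 * c / 2 = c := by omega
        have e2 : 2 * r / 2 = r := by omega
        rw [e1, e2, pow_add, pow_mul]
        rcases neg_one_pow_eq_or F c with h | h <;> rw [h] <;> simp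
      · obtain ⟨c, rfl⟩ : ∃ c, m = r + c + 1 := ⟨m - r - 1, by omega⟩
        obtain rfl : k = 2 * c + 1 := by omega
        have e1 : (2 * c + 1) / 2 = c := by omega
        have e2 : (2 * r + 1) / 2 = r := by omega
        rw [e1, e2, pow_add, pow_add, pow_add, pow_mul]
        rcases neg_one_pow_eq_or F c with h | h <;> rw [h] <;> simp
    · simp
  exact LinearMap.congr_fun₂ this v w

/-- Pairing with $e_{2m-k}$ extracts the $k$-th coordinate up to sign; the other side follows by
exchanging arguments. -/
theorem superForm_nondegenerate : (superForm F m).Nondegenerate := by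
  have key : ∀ (v : OspV F m) (k : Fin (2 * m + 1)),
      superForm F m (e F m (2 * m - k)) v = (-1) ^ ((2 * m - k) / 2) * v k := by
    intro v k
    have : superForm F m (e F m (2 * m - k)) =
        ((-1 : F) ^ ((2 * m - k) / 2)) • (LinearMap.proj k : OspV F m →ₗ[F] F) := by
      refine ext_e fun l _ => ?_
      have := k.2
      simp only [superForm_e, LinearMap.smul_apply, LinearMap.proj_apply, e, smul_eq_mul,
        mul_ite, mul_one, mul_zero]
      congr 1
      rw [eq_iff_iff]
      omega
    exact LinearMap.congr_fun this v
  have hR : LinearMap.SeparatingRight (superForm F m) := fun v hv => by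
    ext k
    have h := key v k
    rw [hv] at h
    simpa using h.symm
  exact ⟨fun v hv => hR v fun w => by rw [superForm_swap, hv, mul_zero], hR⟩

variable {F m}

variable [CharZero F] {b : LinearMap.BilinForm F (OspV F m)}

theorem opForm_apply {i : ZMod 2} {v : OspV F m}
    (hv : v ∈ grading F m i) (w : OspV F m) : opForm F m b v w = superSign F i * b v w := by
  change b (parityOp F m v) w = _
  rw [((isParityOp_parityOp F m).mem_iff _ _).1 hv, map_smul, LinearMap.smul_apply, smul_eq_mul]

theorem IsSupersymmetricOp.apply {z : Module.End F (OspV F m)} (hs : IsSupersymmetricOp F m b z)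
    {j : ZMod 2} {v : OspV F m} (hv : v ∈ grading F m j) (w : OspV F m) :
    b (z v) w = superSign F j * b v (z w) := by
  have h : b (z v) = superSign F j • (b v).comp z :=
    (isParityOp_parityOp F m).ext_homogeneous fun l w hw => hs _ l v hv w hw
  rw [h]
  rfl

/-- The twist gives $(zv\mid w)'=(-1)^{|zv|}(v\mid zw)'$, and $|zv|=|v|+1$ is the parity of $v$ in
$V(m)^{op}$, so supersymmetry survives. -/
theorem IsSupersymmetricOp.opForm_adjoint {z : Module.End F (OspV F m)}
    (hz : z ∈ endGrading (grading F m) 1)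
    (hs : IsSupersymmetricOp F m b z) {j : ZMod 2} {v w : OspV F m}
    (hv : v ∈ opGrading (grading F m) j) :
    opForm F m b (z v) w = superSign F j * opForm F m b v (z w) := by
  have h := hz _ v hv
  rw [opForm_apply h, opForm_apply hv]
  have h2 := hs.apply hv w
  rw [h2, superSign_add, superSign_add, superSign_one]
  ring

/-! ### Uniqueness and symmetry of invariant forms. -/

namespace IsInvariantForm

/-- An invariant form on `V(m)` is a nonzero multiple of the standard one. -/
theorem exists_eq_smul (hb : IsInvariantForm F m b) : ∃ c : F, c ≠ 0 ∧ b = c • superForm F m := by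
  -- Moving $\rho_y$ from the left argument to the right, one factor at a time, reduces every value
  -- to one at $e_0$.
  have h1 : ∀ j k : ℕ, j < 2 * m + 1 →
      b (e F m j) (e F m k) = (-1) ^ (j / 2) * b (e F m 0) (e F m (j + k)) := by
    intro j
    induction j with
    | zero => intro k _; simp
    | succ j ih =>
      intro k hj
      have h := hb.supersymm_y j k _ (e_mem_grading F m j) _ (e_mem_grading F m k)
      have hY : rhoY F m (e F m k) = e F m (k + 1) := by
        by_cases hk : k < 2 * m + 1
        · exact rhoY_e F m hk
        · rw [e_eq_zero F m (k := k) (by omega), e_eq_zero F m (k := k + 1) (by omega), map_zero]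
      rw [rhoY_e F m (by omega), hY, superSign_natCast, ih (k + 1) (by omega)] at h
      rw [h, ← add_assoc, add_right_comm j k 1, ← mul_assoc]
      congr 1
      rcases Nat.even_or_odd' j with ⟨r, rfl | rfl⟩
      · have e1 : (2 * r + 1) / 2 = r := by omega
        have e2 : 2 * r / 2 = r := by omega
        rw [e1, e2]; simp
      · have e1 : (2 * r + 1 + 1) / 2 = r + 1 := by omega
        have e2 : (2 * r + 1) / 2 = r := by omega
        rw [e1, e2]; simp [pow_succ]
  -- $\rho_xe_0=0$, while $\rho_xe_{k+1}$ is a nonzero multiple of $e_k$ for $k<2m$ in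
  -- characteristic $0$; so $e_0$ pairs only with $e_{2m}$.
  have h2 : ∀ k < 2 * m, b (e F m 0) (e F m k) = 0 := by
    intro k hk
    have h := hb.supersymm_x (0 : ℕ) (k + 1 : ℕ) _ (e_mem_grading F m 0) _
      (e_mem_grading F m (k + 1))
    rw [rhoX_e F m (k := 0) (by omega), rhoX_e F m (by omega), superSign_natCast] at h
    simp only [map_smul, smul_eq_mul, Nat.add_sub_cancel] at h
    simp only [Even.zero, if_true, Nat.zero_div, Nat.cast_zero, neg_zero, zero_smul,
      LinearMap.zero_apply, pow_zero, one_mul] at h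
    refine (mul_eq_zero.1 h.symm).resolve_left ?_
    split_ifs with hev
    · rw [← ne_eq, neg_ne_zero, Nat.cast_ne_zero]
      obtain ⟨r, hr⟩ := hev
      omega
    · rw [← ne_eq, sub_ne_zero, Nat.cast_inj.ne]
      rw [Nat.even_iff] at hev
      omega
  have h3 : b = b (e F m 0) (e F m (2 * m)) • superForm F m := by
    refine ext_e fun j hj => ext_e fun k hk => ?_
    rw [h1 j k hj, LinearMap.smul_apply, LinearMap.smul_apply, superForm_e, smul_eq_mul]
    split_ifs with h
    · rw [h, mul_comm]
    · rw [mul_zero]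
      rcases lt_or_gt_of_ne h with h | h
      · rw [h2 _ h, mul_zero]
      · rw [e_eq_zero F m h, map_zero, mul_zero]
  refine ⟨_, fun h0 => hb.ne_zero ?_, h3⟩
  rw [h3, h0, zero_smul]

theorem swap (hb : IsInvariantForm F m b) {i : ZMod 2} {v : OspV F m} (hv : v ∈ grading F m i)
    (w : OspV F m) : b v w = (-1) ^ m * superSign F i * b w v := by
  obtain ⟨c, -, rfl⟩ := hb.exists_eq_smul
  simp only [LinearMap.smul_apply, smul_eq_mul]
  rw [superForm_swap, ((isParityOp_parityOp F m).mem_iff _ _).1 hv, map_smul, smul_eq_mul]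
  ring

theorem nondegenerate (hb : IsInvariantForm F m b) : b.Nondegenerate := by
  obtain ⟨c, hc, rfl⟩ := hb.exists_eq_smul
  have h := superForm_nondegenerate F m
  refine ⟨fun v hv => h.1 v fun w => ?_, fun v hv => h.2 v fun w => ?_⟩
  · exact (mul_eq_zero.1 (hv w)).resolve_left hc
  · exact (mul_eq_zero.1 (hv w)).resolve_left hc

theorem isSuperform (hb : IsInvariantForm F m b) (hm : Even m) :
    IsSuperform (grading F m) b where
  nondegenerate := hb.nondegenerate
  orthogonal := hb.even
  symm_even v hv w _ := by rw [hb.swap hv, hm.neg_one_pow]; simp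
  skew_odd v hv w _ := by rw [hb.swap hv, hm.neg_one_pow]; simp

/-- For odd $m$ the form is skew on even and symmetric on odd vectors of $V(m)$. Exchanging parities
puts this right, and the twist is constant on each parity component. -/
theorem isSuperform_opForm (hb : IsInvariantForm F m b) (hm : Odd m) :
    IsSuperform (opGrading (grading F m)) (opForm F m b) where
  nondegenerate := by
    have hS := (isParityOp_parityOp F m).apply_apply
    refine ⟨fun v hv => ?_, fun v hv => hb.nondegenerate.2 v fun w => ?_⟩
    · rw [← hS v, hb.nondegenerate.1 (parityOp F m v) hv, map_zero]
    · rw [← hS w]; exact hv _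
  orthogonal i j hij v hv w hw := by
    rw [opForm_apply hv, hb.even _ _ (fun h => hij (add_right_cancel h)) v hv w hw, mul_zero]
  symm_even v hv w hw := by
    rw [opForm_apply hv, opForm_apply hw, hb.swap hv, hm.neg_one_pow]; simp
  skew_odd v hv w hw := by
    have h : (1 + 1 : ZMod 2) = 0 := rfl
    rw [opForm_apply hv, opForm_apply hw, hb.swap hv, hm.neg_one_pow]; simp [h]

end IsInvariantForm

/-- The operators of `D_t` on `V(m)` are hermitian as soon as `x` and `y` are supersymmetric. -/
theorem dAction_mem_hermitianPart {𝒲 : ZMod 2 → Submodule F (OspV F m)}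
    {S : Module.End F (OspV F m)} (hS : IsParityOp 𝒲 S) {b : LinearMap.BilinForm F (OspV F m)}
    (hb : IsSuperform 𝒲 b) {star : Module.End F (OspV F m) →ₗ[F] Module.End F (OspV F m)}
    (hstar : IsAssociatedSuperinvolution 𝒲 b star)
    (hX : rhoX F m ∈ endGrading 𝒲 1) (hY : rhoY F m ∈ endGrading 𝒲 1)
    (hbX : ∀ j, ∀ v ∈ 𝒲 j, ∀ w, b (rhoX F m v) w = superSign F j * b v (rhoX F m w))
    (hbY : ∀ j, ∀ v ∈ 𝒲 j, ∀ w, b (rhoY F m v) w = superSign F j * b v (rhoY F m w))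
    (t : F) (a : KacD F t) : dAction F m t a ∈ hermitianPart star := by
  have hz : ∀ z ∈ endGrading 𝒲 1,
      (∀ j, ∀ v ∈ 𝒲 j, ∀ w, b (z v) w = superSign F j * b v (z w)) → star z = z := by
    refine fun z hz h => hS.eq_of_form_eq hb fun j v hv w => ?_
    have h1 := hstar.adjoint 1 j z hz v hv w
    rw [h j v hv w, one_mul] at h1
    exact (mul_left_cancel₀ (superSign_ne_zero F j) h1).symm
  have h1 : star 1 = 1 := by
    refine hS.eq_of_form_eq hb fun j v hv w => ?_
    have h1 := hstar.adjoint 0 j 1 (fun l u hu => by rwa [zero_add]) v hv w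
    rw [zero_mul, superSign_zero, one_mul] at h1
    exact h1.symm
  have hsX := hz _ hX hbX
  have hsY := hz _ hY hbY
  -- Both factors are odd, so the superinvolution sends $\rho_x\rho_y$ to $-\rho_y\rho_x$ and fixes
  -- the commutator.
  have hXY := hstar.superinvolution.map_mul 1 1 _ hX _ hY
  have hYX := hstar.superinvolution.map_mul 1 1 _ hY _ hX
  rw [hsX, hsY, one_mul, superSign_one, neg_one_smul] at hXY hYX
  have hcomm : star (rhoX F m * rhoY F m - rhoY F m * rhoX F m) =
      rhoX F m * rhoY F m - rhoY F m * rhoX F m := by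
    rw [map_sub, hXY, hYX]; abel
  change star _ = _
  simp only [dAction, map_add, map_smul, hcomm, h1, hsX, hsY]
  rfl

end OspV

/-! ### Irreducible representations of `D_t` -/

section Representation

variable {F V : Type*} [Field F] [AddCommGroup V] [Module F V]

theorem apply_parityProj {𝒱 : ZMod 2 → Submodule F V} [DirectSum.Decomposition 𝒱]
   {i : ZMod 2} {f : Module.End F V}
    (hf : f ∈ endGrading 𝒱 i) (j : ZMod 2) (v : V) :
    f (parityProj 𝒱 j v) = parityProj 𝒱 (i + j) (f v) := by
  have h : f * parityProj 𝒱 j = parityProj 𝒱 (i + j) * f := by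
    refine end_ext_homogeneous 𝒱 fun k w hw => ?_
    simp only [Module.End.mul_apply, parityProj_apply]
    by_cases hjk : k = j
    · subst hjk
      rw [DirectSum.decompose_of_mem_same 𝒱 hw, DirectSum.decompose_of_mem_same 𝒱 (hf _ _ hw)]
    · rw [DirectSum.decompose_of_mem_ne 𝒱 hw hjk, map_zero,
        DirectSum.decompose_of_mem_ne 𝒱 (hf _ _ hw) fun h => hjk (add_left_cancel h)]
  exact LinearMap.congr_fun h v

/-- Operators `E`, `U`, `Y` on a superspace that satisfy the relations of `e`, `u`, `v` in a
unital special representation of `D_t`. -/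
structure IsKacDTriple (𝒱 : ZMod 2 → Submodule F V) (t : F) (E U Y : Module.End F V) : Prop where
  even_E : E ∈ endGrading 𝒱 0
  odd_U : U ∈ endGrading 𝒱 1
  odd_Y : Y ∈ endGrading 𝒱 1
  mul_self : E * E = E
  add_U : E * U + U * E = U
  add_Y : E * Y + Y * E = Y
  comm : U * Y - Y * U = (2 : F) • (t • 1 + (1 - t) • E)

namespace IsKacDTriple

variable {𝒱 : ZMod 2 → Submodule F V} {t : F} {E U Y : Module.End F V}

/-- $[U^2,Y]=U[U,Y]+[U,Y]U$, and $EU+UE=U$ eliminates $E$. -/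
theorem comm_sq (h : IsKacDTriple 𝒱 t E U Y) :
    U * U * Y - Y * (U * U) = (2 * (1 + t)) • U := by
  have h1 : U * U * Y - Y * (U * U) = U * (U * Y - Y * U) + (U * Y - Y * U) * U := by noncomm_ring
  have h2 : U * E = U - E * U := by rw [eq_sub_iff_add_eq', h.add_U]
  rw [h1, h.comm]
  simp only [mul_smul_comm, smul_mul_assoc, mul_add, add_mul, mul_one, one_mul, h2]
  module

/-- If $U$ had an inverse $W$, then $[U^2,Y]W$ would have trace $\mathrm{tr}(UY)-\mathrm{tr}(YU)=0$,
but it equals $2(1+t)\,\mathrm{id}$. -/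
theorem exists_ker [CharZero F] [FiniteDimensional F V] [Nontrivial V] (ht : t ≠ -1)
    (h : IsKacDTriple 𝒱 t E U Y) : ∃ w, w ≠ 0 ∧ U w = 0 := by
  by_contra! hw
  have hinj : Function.Injective U :=
    (injective_iff_map_eq_zero U).2 fun w h0 => by_contra fun hne => hw w hne h0
  obtain ⟨W, hW⟩ := LinearMap.exists_rightInverse_of_surjective U
    (LinearMap.range_eq_top.2 (LinearMap.injective_iff_surjective.1 hinj))
  have hUW : U * W = 1 := hW
  have hWU : W * U = 1 := mul_eq_one_comm.1 hUW
  have h1 := congrArg (fun f => LinearMap.trace F V (f * W)) h.comm_sq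
  have h2 : U * U * Y * W = U * (U * Y * W) := by noncomm_ring
  have h3 : Y * (U * U) * W = Y * U * (U * W) := by noncomm_ring
  simp only [sub_mul, map_sub, smul_mul_assoc, map_smul, hUW, h3, mul_one] at h1
  rw [h2, LinearMap.trace_mul_comm, mul_assoc, mul_assoc, hWU, mul_one,
    LinearMap.trace_mul_comm, sub_self, LinearMap.trace_one, smul_eq_mul] at h1
  have h4 : (Module.finrank F V : F) ≠ 0 := Nat.cast_ne_zero.2 Module.finrank_pos.ne'
  have h5 : 1 + t ≠ 0 := fun h0 => ht (eq_neg_of_add_eq_zero_right h0)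
  exact mul_ne_zero (mul_ne_zero two_ne_zero h5) h4 h1.symm

/-- A homogeneous lowest weight vector. -/
theorem exists_lowest [CharZero F] [FiniteDimensional F V] [Nontrivial V]
    [DirectSum.Decomposition 𝒱] (ht : t ≠ -1) (h : IsKacDTriple 𝒱 t E U Y) :
    ∃ j, ∃ v ∈ 𝒱 j, v ≠ 0 ∧ U v = 0 ∧ ∃ s : F, (s = 0 ∨ s = 1) ∧ E v = s • v := by
  obtain ⟨w, hw, hUw⟩ := h.exists_ker ht
  obtain ⟨x, hx, hUx, s, hs, hEx⟩ :
      ∃ x, x ≠ 0 ∧ U x = 0 ∧ ∃ s : F, (s = 0 ∨ s = 1) ∧ E x = s • x := by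
    -- $E$ preserves $\ker U$, because $UEw=Uw-EUw$; so either $w$ or $Ew$ is an eigenvector of the
    -- idempotent in that kernel.
    by_cases hE : E w = 0
    · exact ⟨w, hw, hUw, 0, Or.inl rfl, by rw [hE, zero_smul]⟩
    · refine ⟨E w, hE, ?_, 1, Or.inr rfl, ?_⟩
      · have h1 := LinearMap.congr_fun h.add_U w
        simpa [hUw] using h1
      · rw [one_smul]; exact LinearMap.congr_fun h.mul_self w
  -- $E$ and $U$ are homogeneous, so any nonzero component of $x$ inherits both properties.
  obtain ⟨j, hj⟩ : ∃ j, parityProj 𝒱 j x ≠ 0 := by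
    by_contra! h0
    refine hx ((DirectSum.decompose 𝒱).injective ?_)
    rw [DirectSum.decompose_zero]
    ext j
    exact h0 j
  refine ⟨j, parityProj 𝒱 j x, SetLike.coe_mem _, hj, ?_, s, hs, ?_⟩
  · rw [apply_parityProj h.odd_U, hUx, map_zero]
  · rw [apply_parityProj h.even_E, hEx, zero_add, map_smul]

/-- The coefficient `c_k` in `u v^k w = c_k v^{k-1} w` for a lowest weight vector `w`, where
`r` is the eigenvalue of `[u, v]` on `w`. -/
noncomputable def lowerCoeff (t r : F) (k : ℕ) : F :=
  if Even k then k * (1 + t) else (k - 1) * (1 + t) + r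

theorem E_pow (h : IsKacDTriple 𝒱 t E U Y) {s : F} {v : V} (hv : E v = s • v) (k : ℕ) :
    E ((Y ^ k) v) = (if Even k then s else 1 - s) • (Y ^ k) v := by
  induction k with
  | zero => simpa using hv
  | succ k ih =>
    have h1 : E (Y ((Y ^ k) v)) = Y ((Y ^ k) v) - Y (E ((Y ^ k) v)) := by
      rw [eq_sub_iff_add_eq]; exact LinearMap.congr_fun h.add_Y _
    rw [pow_succ', Module.End.mul_apply, h1, ih, map_smul]
    simp only [Nat.even_add_one]
    split_ifs
    · rw [sub_smul, one_smul]
    · rw [sub_smul, one_smul]; abel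

/-- $YE=(1-E)Y$ makes the eigenvalue of $E$ alternate between $s$ and $1-s$, so $[U,Y]$ alternates
between $r$ and $2(1+t)-r$, with $r=2(t+(1-t)s)$; the coefficients are the partial sums. At $k=0$
the truncated exponent is harmless, as the coefficient vanishes. -/
theorem U_pow (h : IsKacDTriple 𝒱 t E U Y) {s : F} {v : V} (hv : E v = s • v) (hU : U v = 0)
    (k : ℕ) : U ((Y ^ k) v) =
      lowerCoeff t (2 * (t + (1 - t) * s)) k • (Y ^ (k - 1)) v := by
  induction k with
  | zero => simp [hU, lowerCoeff]
  | succ k ih =>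
    have h1 : U (Y ((Y ^ k) v)) = Y (U ((Y ^ k) v)) +
        (2 : F) • (t • (Y ^ k) v + (1 - t) • E ((Y ^ k) v)) := by
      rw [← sub_eq_iff_eq_add']; exact LinearMap.congr_fun h.comm _
    rw [pow_succ', Module.End.mul_apply, h1, ih, h.E_pow hv, map_smul, Nat.add_sub_cancel]
    rcases k with _ | k
    · simp only [lowerCoeff, Even.zero, if_true, zero_add, Nat.not_even_one, if_false]
      simp only [Nat.cast_zero, zero_mul, zero_smul, pow_zero, Module.End.one_apply, Nat.cast_one,
        sub_self]
      module
    · rw [Nat.add_sub_cancel, ← Module.End.mul_apply, ← pow_succ']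
      simp only [lowerCoeff, Nat.even_add_one, not_not]
      split_ifs
      · push_cast; module
      · push_cast; module

/-- The eigenvalue is $c_k+c_{k+1}$, in which the dependence on the parity of $k$ cancels. Being
affine in $k$ with slope $2(1+t)\neq0$ when $t\neq-1$, it separates the powers. -/
theorem UY_add_YU_pow (h : IsKacDTriple 𝒱 t E U Y) {s : F} {v : V} (hv : E v = s • v)
    (hU : U v = 0) (k : ℕ) : (U * Y + Y * U) ((Y ^ k) v) =
      (2 * k * (1 + t) + 2 * (t + (1 - t) * s)) • (Y ^ k) v := by
  rw [LinearMap.add_apply, Module.End.mul_apply, Module.End.mul_apply, ← Module.End.mul_apply Y,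
    ← pow_succ', h.U_pow hv hU, h.U_pow hv hU, map_smul, ← Module.End.mul_apply Y, ← pow_succ',
    Nat.add_sub_cancel]
  rcases k with _ | k
  · simp [lowerCoeff]
  · rw [Nat.add_sub_cancel, ← add_smul]
    congr 1
    simp only [lowerCoeff, Nat.even_add_one, not_not]
    split_ifs <;> push_cast <;> ring

theorem linearIndependent_pow [CharZero F] (ht : t ≠ -1) (h : IsKacDTriple 𝒱 t E U Y) {s : F}
    {v : V} (hv : E v = s • v) (hU : U v = 0) (n : ℕ) (hn : ∀ k < n, (Y ^ k) v ≠ 0) :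
    LinearIndependent F fun k : Fin n => (Y ^ (k : ℕ)) v := by
  have h1 : 1 + t ≠ 0 := fun h0 => ht (eq_neg_of_add_eq_zero_right h0)
  refine Module.End.eigenvectors_linearIndependent' (U * Y + Y * U)
    (fun k : Fin n => 2 * (k : ℕ) * (1 + t) + 2 * (t + (1 - t) * s)) (fun k l hkl => ?_) _
    fun k => ⟨Module.End.mem_eigenspace_iff.2 (h.UY_add_YU_pow hv hU k), hn k k.2⟩
  have h2 := mul_right_cancel₀ h1 (add_right_cancel hkl)
  exact Fin.ext (Nat.cast_injective (mul_left_cancel₀ two_ne_zero h2))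

/-- An irreducible finite dimensional representation of `D_t` is a module `V(m)`, up to parity. -/
theorem exists_equiv [CharZero F] [FiniteDimensional F V] [Nontrivial V]
    [DirectSum.Decomposition 𝒱] (ht0 : t ≠ 0) (ht : t ≠ -1) (h : IsKacDTriple 𝒱 t E U Y)
    (hirr : ∀ S : Submodule F V, (∀ w ∈ S, E w ∈ S) → (∀ w ∈ S, U w ∈ S) →
      (∀ w ∈ S, Y w ∈ S) → S ≠ ⊥ → S = ⊤) :
    ∃ m : ℕ, 1 ≤ m ∧ (t = -((m : F) / (m + 1)) ∨ t = -(((m : F) + 1) / m)) ∧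
      ∃ φ : V ≃ₗ[F] OspV F m, IsHomogeneousEquiv 𝒱 (OspV.grading F m) φ ∧
        (∀ w, φ (U w) = (2 : F) • OspV.rhoX F m (φ w)) ∧
        ∀ w, φ (Y w) = (-(1 + t)) • OspV.rhoY F m (φ w) := by
  have h1t : 1 + t ≠ 0 := fun h0 => ht (eq_neg_of_add_eq_zero_right h0)
  obtain ⟨j, v, hvj, hv0, hUv, s, hs, hEv⟩ := h.exists_lowest ht
  set r := 2 * (t + (1 - t) * s) with hr
  have hex : ∃ n, (Y ^ n) v = 0 := by
    by_contra! hn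
    have := (h.linearIndependent_pow ht hEv hUv (Module.finrank F V + 1)
      fun k _ => hn k).fintype_card_le_finrank
    simp at this
  classical
  obtain ⟨n, hn, hlt⟩ : ∃ n, (Y ^ n) v = 0 ∧ ∀ k < n, (Y ^ k) v ≠ 0 :=
    ⟨Nat.find hex, Nat.find_spec hex, fun k hk => Nat.find_min hex hk⟩
  have hn0 : n ≠ 0 := by
    rintro rfl
    exact hv0 (by simpa using hn)
  -- Apply $U$ to $Y^nv=0$; minimality of $n$ gives $Y^{n-1}v\neq0$.
  have hc : lowerCoeff t r n = 0 := by
    have h1 := h.U_pow hEv hUv n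
    rw [hn, map_zero] at h1
    exact (smul_eq_zero.1 h1.symm).resolve_right (hlt _ (by omega))
  obtain ⟨m, rfl⟩ : ∃ m, n = 2 * m + 1 := by
    rcases Nat.even_or_odd' n with ⟨m, rfl | rfl⟩
    · rw [lowerCoeff, if_pos (even_two_mul m)] at hc
      exact absurd hc (mul_ne_zero (Nat.cast_ne_zero.2 hn0) h1t)
    · exact ⟨m, rfl⟩
  have hrm : r = -(2 * m * (1 + t)) := by
    rw [lowerCoeff, if_neg (by simp)] at hc
    push_cast at hc
    linear_combination hc
  have hm : 1 ≤ m := by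
    rw [Nat.one_le_iff_ne_zero]
    rintro rfl
    rw [hr] at hrm
    -- With $m=0$ the relation reads $2t=0$ for $s=0$ and $2=0$ for $s=1$.
    rcases hs with rfl | rfl <;> simp [ht0] at hrm
  refine ⟨m, hm, ?_, ?_⟩
  · have hm0 : (m : F) ≠ 0 := Nat.cast_ne_zero.2 (by omega)
    have hm1 : (m : F) + 1 ≠ 0 := Nat.cast_add_one_ne_zero m
    rw [hr] at hrm
    have h2 : (2 : F) ≠ 0 := two_ne_zero
    rcases hs with rfl | rfl
    · left
      rw [← neg_div, eq_div_iff hm1, ← mul_right_inj' h2]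
      linear_combination hrm
    · right
      rw [← neg_div, eq_div_iff hm0, ← mul_right_inj' h2]
      linear_combination hrm
  set a := -(1 + t) with ha
  have ha0 : a ≠ 0 := neg_ne_zero.2 h1t
  -- The scaling makes $Y$ act as $-(1+t)$ times the shift $\rho_y$; the coefficients of $U$ then
  -- become those of $2\rho_x$.
  let w : ℕ → V := fun k => a⁻¹ ^ k • (Y ^ k) v
  have hwE : ∀ k, ∃ c : F, E (w k) = c • w k := fun k => by
    refine ⟨if Even k then s else 1 - s, ?_⟩
    rw [map_smul, h.E_pow hEv, smul_comm]
  have hwY : ∀ k, Y (w k) = a • w (k + 1) := fun k => by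
    rw [map_smul, ← Module.End.mul_apply, ← pow_succ', smul_smul, pow_succ' a⁻¹, ← mul_assoc,
      mul_inv_cancel₀ ha0, one_mul]
  have hwU : ∀ k, U (w k) = (2 * if Even k then -((k / 2 : ℕ) : F)
      else (m : F) - ((k / 2 : ℕ) : F)) • w (k - 1) := fun k => by
    rw [map_smul, h.U_pow hEv hUv, ← hr, smul_smul, smul_smul]
    rcases k with _ | k
    · simp [lowerCoeff]
    · congr 1
      rw [Nat.add_sub_cancel, pow_succ, mul_right_comm, mul_comm _ (a⁻¹ ^ k), mul_assoc]
      congr 1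
      rw [← div_eq_mul_inv, div_eq_iff ha0, lowerCoeff, hrm, ha]
      rcases Nat.even_or_odd' (k + 1) with ⟨i, hi | hi⟩
      · rw [hi, if_pos (even_two_mul i), if_pos (even_two_mul i)]
        have e1 : 2 * i / 2 = i := by omega
        rw [e1]; push_cast; ring
      · rw [hi, if_neg (by simp), if_neg (by simp)]
        have e1 : (2 * i + 1) / 2 = i := by omega
        rw [e1]; push_cast; ring
  have hw0 : ∀ k, 2 * m < k → w k = 0 := fun k hk => by
    obtain ⟨l, rfl⟩ : ∃ l, k = l + (2 * m + 1) := ⟨k - (2 * m + 1), by omega⟩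
    change _ • (Y ^ (l + (2 * m + 1))) v = 0
    rw [pow_add Y, Module.End.mul_apply, hn, map_zero, smul_zero]
  have hwj : ∀ k : ℕ, w k ∈ 𝒱 (k + j) := fun k => by
    refine Submodule.smul_mem _ _ ?_
    induction k with
    | zero => simpa using hvj
    | succ k ih =>
      rw [pow_succ', Module.End.mul_apply]
      have := h.odd_Y _ _ ih
      rwa [← add_assoc, add_comm 1, ← Nat.cast_add_one] at this
  have hli : LinearIndependent F fun k : Fin (2 * m + 1) => w k := by
    have := (h.linearIndependent_pow ht hEv hUv (2 * m + 1) hlt).units_smul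
      fun k => Units.mk0 (a⁻¹ ^ (k : ℕ)) (pow_ne_zero _ (inv_ne_zero ha0))
    exact this
  have hspan : Submodule.span F (Set.range fun k : Fin (2 * m + 1) => w k) = ⊤ := by
    have hmem : ∀ k, w k ∈ Submodule.span F (Set.range fun k : Fin (2 * m + 1) => w k) :=
      fun k => by
        by_cases hk : k < 2 * m + 1
        · exact Submodule.subset_span ⟨⟨k, hk⟩, rfl⟩
        · rw [hw0 k (by omega)]; exact Submodule.zero_mem _
    have hstab : ∀ f : Module.End F V,
        (∀ k, f (w k) ∈ Submodule.span F (Set.range fun k : Fin (2 * m + 1) => w k)) →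
        ∀ x ∈ Submodule.span F (Set.range fun k : Fin (2 * m + 1) => w k),
          f x ∈ Submodule.span F (Set.range fun k : Fin (2 * m + 1) => w k) := by
      intro f hf x hx
      refine Submodule.span_le (p := Submodule.comap f (Submodule.span F _)).2 ?_ hx
      rintro _ ⟨k, rfl⟩
      exact hf k
    refine hirr _ (hstab E fun k => ?_) (hstab U fun k => ?_) (hstab Y fun k => ?_) ?_
    · obtain ⟨c, hc⟩ := hwE k
      rw [hc]; exact Submodule.smul_mem _ _ (hmem k)
    · rw [hwU]; exact Submodule.smul_mem _ _ (hmem _)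
    · rw [hwY]; exact Submodule.smul_mem _ _ (hmem _)
    · intro hbot
      have := hmem 0
      rw [hbot, Submodule.mem_bot] at this
      exact hv0 (by simpa [w] using this)
  let bv : Module.Basis (Fin (2 * m + 1)) F V := Module.Basis.mk hli hspan.ge
  have hbv : ∀ k : Fin (2 * m + 1), bv k = w k := fun k => Module.Basis.mk_apply hli hspan.ge k
  let φ : V ≃ₗ[F] OspV F m := bv.equivFun
  have hφ : ∀ k, φ (w k) = OspV.e F m k := fun k => by
    by_cases hk : k < 2 * m + 1
    · rw [← hbv ⟨k, hk⟩]
      ext i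
      rw [bv.equivFun_self]
      simp [OspV.e, Fin.ext_iff, eq_comm]
    · rw [hw0 k (by omega), OspV.e_eq_zero F m (by omega), map_zero]
  -- The vector sent to $e_k$ has parity $k+j$, hence the shift by $-j$.
  refine ⟨φ, ⟨-j, fun i x hx => ?_⟩, fun x => ?_, fun x => ?_⟩
  · have hproj : ∀ k : Fin (2 * m + 1),
        φ (parityProj 𝒱 i (w k)) ∈ OspV.grading F m (i + -j) := fun k => by
      by_cases hk : ((k : ℕ) : ZMod 2) + j = i
      · subst hk
        rw [parityProj_apply, DirectSum.decompose_of_mem_same 𝒱 (hwj k), hφ,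
          add_neg_cancel_right]
        exact OspV.e_mem_grading F m k
      · rw [parityProj_apply, DirectSum.decompose_of_mem_ne 𝒱 (hwj k) hk, map_zero]
        exact Submodule.zero_mem _
    have hx' : parityProj 𝒱 i x = x := DirectSum.decompose_of_mem_same 𝒱 hx
    rw [← hx', ← bv.sum_repr x, map_sum, map_sum]
    refine Submodule.sum_mem _ fun k _ => ?_
    rw [map_smul, map_smul, hbv]
    exact Submodule.smul_mem _ _ (hproj k)
  · have : φ.toLinearMap ∘ₗ U = (2 : F) • (OspV.rhoX F m ∘ₗ φ.toLinearMap) := by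
      refine bv.ext fun k => ?_
      simp only [LinearMap.comp_apply, LinearMap.smul_apply, LinearEquiv.coe_coe, hbv, hwU,
        map_smul, hφ]
      rw [OspV.rhoX_e F m k.2, smul_smul]
    exact LinearMap.congr_fun this x
  · have : φ.toLinearMap ∘ₗ Y = a • (OspV.rhoY F m ∘ₗ φ.toLinearMap) := by
      refine bv.ext fun k => ?_
      simp only [LinearMap.comp_apply, LinearMap.smul_apply, LinearEquiv.coe_coe, hbv, hwY,
        map_smul, hφ]
      rw [OspV.rhoY_e F m k.2]
    exact LinearMap.congr_fun this x

end IsKacDTriple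

end Representation

/-! ### Jordan products of homogeneous elements and the multiplication table of $D_t$. -/

section JordanProduct

variable {F A : Type*} [Field F] [Ring A] [Algebra F A]

theorem jordanMul_of_mem (𝒜 : ZMod 2 → Submodule F A) [GradedAlgebra 𝒜] {i j : ZMod 2} {a b : A}
    (ha : a ∈ 𝒜 i) (hb : b ∈ 𝒜 j) :
    jordanMul 𝒜 a b = (2⁻¹ : F) • (a * b + superSign F (i * j) • (b * a)) := by
  rw [jordanMul, Finset.sum_eq_single i, Finset.sum_eq_single j,
    DirectSum.decompose_of_mem_same 𝒜 ha, DirectSum.decompose_of_mem_same 𝒜 hb]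
  · intro k _ hk
    rw [DirectSum.decompose_of_mem_ne 𝒜 hb hk.symm]; simp
  · simp
  · intro k _ hk
    rw [DirectSum.decompose_of_mem_ne 𝒜 ha hk.symm]; simp
  · simp

end JordanProduct

namespace KacD

variable (F : Type*) [Field F] (t : F)

/-- The basis element `e` of `D_t`. -/
def e : KacD F t := (![1, 0, 0, 0] : Fin 4 → F)

/-- The basis element `f` of `D_t`. -/
def f : KacD F t := (![0, 1, 0, 0] : Fin 4 → F)

/-- The basis element `u` of `D_t`. -/
def u : KacD F t := (![0, 0, 1, 0] : Fin 4 → F)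

/-- The basis element `v` of `D_t`. -/
def v : KacD F t := (![0, 0, 0, 1] : Fin 4 → F)

theorem e_mem : e F t ∈ grading F t 0 := by
  rw [grading, if_pos rfl]
  exact Submodule.subset_span (Set.mem_insert _ _)

theorem f_mem : f F t ∈ grading F t 0 := by
  rw [grading, if_pos rfl]
  exact Submodule.subset_span (Set.mem_insert_of_mem _ rfl)

theorem u_mem : u F t ∈ grading F t 1 := by
  rw [grading, if_neg one_ne_zero]
  exact Submodule.subset_span (Set.mem_insert _ _)

theorem v_mem : v F t ∈ grading F t 1 := by
  rw [grading, if_neg one_ne_zero]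
  exact Submodule.subset_span (Set.mem_insert_of_mem _ rfl)

theorem mul_def (a b : KacD F t) : a * b = (![a 0 * b 0 + (a 2 * b 3 - a 3 * b 2),
    a 1 * b 1 + t * (a 2 * b 3 - a 3 * b 2),
    2⁻¹ * ((a 0 + a 1) * b 2 + (b 0 + b 1) * a 2),
    2⁻¹ * ((a 0 + a 1) * b 3 + (b 0 + b 1) * a 3)] : Fin 4 → F) := rfl

theorem e_mul_e : e F t * e F t = e F t := by
  rw [mul_def]; funext i; fin_cases i <;> simp [e]

theorem e_mul_u : e F t * u F t = (2⁻¹ : F) • u F t := by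
  rw [mul_def]; funext i
  change _ = (2⁻¹ : F) * (u F t i)
  fin_cases i <;> simp [e, u]

theorem e_mul_v : e F t * v F t = (2⁻¹ : F) • v F t := by
  rw [mul_def]; funext i
  change _ = (2⁻¹ : F) * (v F t i)
  fin_cases i <;> simp [e, v]

theorem u_mul_v : u F t * v F t = e F t + t • f F t := by
  rw [mul_def]; funext i
  change _ = e F t i + t * (f F t i)
  fin_cases i <;> simp [e, f, u, v]

theorem e_add_f_mul [CharZero F] (a : KacD F t) : (e F t + f F t) * a = a := by
  have h0 : (e F t + f F t) 0 = 1 := add_zero (1 : F)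
  have h1 : (e F t + f F t) 1 = 1 := zero_add (1 : F)
  have h2 : (e F t + f F t) 2 = 0 := zero_add (0 : F)
  have h3 : (e F t + f F t) 3 = 0 := zero_add (0 : F)
  have h : (1 + 1 : F) = 2 := one_add_one_eq_two
  rw [mul_def]; funext i
  fin_cases i <;> simp [h0, h1, h2, h3, h]

theorem eq_sum (a : KacD F t) :
    a = a 0 • e F t + a 1 • f F t + a 2 • u F t + a 3 • v F t := by
  funext i
  change _ = a 0 * e F t i + a 1 * f F t i + a 2 * u F t i + a 3 * v F t i
  fin_cases i <;> simp [e, f, u, v]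

end KacD

/-! ### From the embedding of $D_t$ to operators on $V$. -/

section KacDIso

variable {F V : Type*} [Field F] [CharZero F] [AddCommGroup V] [Module F V]
  {𝒱 : ZMod 2 → Submodule F V} [DirectSum.Decomposition 𝒱] {t : F}
  {B : Submodule F (Module.End F V)} {ψ : KacD F t ≃ₗ[F] B}

/-- Units are unique: multiply $e+f$, the unit of $D_t$, by the preimage of the identity operator
and compare both readings of the product. -/
theorem IsKacDIso.e_add_f (hψ : IsKacDIso (endGrading 𝒱) B t ψ) (h1 : (1 : Module.End F V) ∈ B) :
    (ψ (KacD.e F t) : Module.End F V) + ψ (KacD.f F t) = 1 := by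
  have h := hψ.map_mul (KacD.e F t + KacD.f F t) (ψ.symm ⟨1, h1⟩)
  have hx : (ψ (KacD.e F t + KacD.f F t) : Module.End F V) ∈ endGrading 𝒱 0 :=
    hψ.graded 0 _ (Submodule.add_mem _ (KacD.e_mem F t) (KacD.f_mem F t))
  have h1' : (1 : Module.End F V) ∈ endGrading 𝒱 0 := fun l u hu => by rwa [zero_add]
  rw [KacD.e_add_f_mul, ψ.apply_symm_apply, jordanMul_of_mem _ hx h1', zero_mul, superSign_zero,
    one_smul, mul_one, one_mul, ← two_smul F, smul_smul, inv_mul_cancel₀ two_ne_zero, one_smul,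
    map_add] at h
  exact h.symm

theorem IsKacDIso.isKacDTriple (hψ : IsKacDIso (endGrading 𝒱) B t ψ)
    (h1 : (1 : Module.End F V) ∈ B) :
    IsKacDTriple 𝒱 t (ψ (KacD.e F t) : Module.End F V) (ψ (KacD.u F t)) (ψ (KacD.v F t)) := by
  have hE := hψ.graded 0 _ (KacD.e_mem F t)
  have hU := hψ.graded 1 _ (KacD.u_mem F t)
  have hY := hψ.graded 1 _ (KacD.v_mem F t)
  have cancel : ∀ x y : Module.End F V, (2⁻¹ : F) • x = (2⁻¹ : F) • y → x = y := fun x y h =>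
    smul_right_injective _ (inv_ne_zero (two_ne_zero (α := F))) h
  refine ⟨hE, hU, hY, ?_, ?_, ?_, ?_⟩
  · have h := hψ.map_mul (KacD.e F t) (KacD.e F t)
    rw [jordanMul_of_mem _ hE hE, KacD.e_mul_e, zero_mul, superSign_zero, one_smul, ← two_smul F,
      smul_smul, inv_mul_cancel₀ two_ne_zero, one_smul] at h
    exact h.symm
  · have h := hψ.map_mul (KacD.e F t) (KacD.u F t)
    rw [jordanMul_of_mem _ hE hU, KacD.e_mul_u, zero_mul, superSign_zero, one_smul, map_smul] at h
    exact (cancel _ _ h).symm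
  · have h := hψ.map_mul (KacD.e F t) (KacD.v F t)
    rw [jordanMul_of_mem _ hE hY, KacD.e_mul_v, zero_mul, superSign_zero, one_smul, map_smul] at h
    exact (cancel _ _ h).symm
  -- For odd operators the Jordan product is half the commutator, so $[U,Y]=2(e+tf)$ with $f=1-e$.
  · have h := hψ.map_mul (KacD.u F t) (KacD.v F t)
    rw [jordanMul_of_mem _ hU hY, KacD.u_mul_v, one_mul, superSign_one, neg_one_smul, map_add,
      map_smul, ← sub_eq_add_neg, eq_comm, inv_smul_eq_iff₀ two_ne_zero] at h
    rw [h, ← hψ.e_add_f h1]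
    simp only [Submodule.coe_add, Submodule.coe_smul]
    module

/-- The image of an element of `D_t` acts by `dAction` as soon as `u` and `v` do. -/
theorem IsKacDIso.apply_eq_dAction (hψ : IsKacDIso (endGrading 𝒱) B t ψ)
    (h1 : (1 : Module.End F V) ∈ B) (ht : t ≠ 1) {m : ℕ} {φ : V ≃ₗ[F] OspV F m}
    (hU : ∀ w, φ ((ψ (KacD.u F t) : Module.End F V) w) = (2 : F) • OspV.rhoX F m (φ w))
    (hY : ∀ w, φ ((ψ (KacD.v F t) : Module.End F V) w) = (-(1 + t)) • OspV.rhoY F m (φ w))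
    (a : KacD F t) (w : V) :
    φ ((ψ a : Module.End F V) w) = OspV.dAction F m t a (φ w) := by
  have ht1 : t - 1 ≠ 0 := sub_ne_zero.2 ht
  have ht2 : 1 - t ≠ 0 := sub_ne_zero.2 ht.symm
  have hc := congrArg φ (LinearMap.congr_fun (hψ.isKacDTriple h1).comm w)
  have hf := congrArg φ (LinearMap.congr_fun (hψ.e_add_f h1) w)
  simp only [LinearMap.add_apply, LinearMap.sub_apply, LinearMap.smul_apply, map_sub, map_add,
    map_smul, Module.End.mul_apply, Module.End.one_apply, hU, hY] at hc hf
  have hE : φ ((ψ (KacD.e F t) : Module.End F V) w) = (t - 1)⁻¹ • (t • φ w +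
      (1 + t) • (OspV.rhoX F m (OspV.rhoY F m (φ w)) - OspV.rhoY F m (OspV.rhoX F m (φ w)))) := by
    rw [eq_inv_smul_iff₀ ht1]
    have h2 : (2 : F) ≠ 0 := two_ne_zero
    apply smul_right_injective _ h2
    linear_combination (norm := module) hc
  have hF : φ ((ψ (KacD.f F t) : Module.End F V) w) = (1 - t)⁻¹ • (φ w +
      (1 + t) • (OspV.rhoX F m (OspV.rhoY F m (φ w)) - OspV.rhoY F m (OspV.rhoX F m (φ w)))) := by
    rw [eq_inv_smul_iff₀ ht2]
    rw [eq_inv_smul_iff₀ ht1] at hE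
    linear_combination (norm := module) (1 - t) • hf + hE
  conv_lhs => rw [KacD.eq_sum F t a]
  simp only [map_add, map_smul, Submodule.coe_add, Submodule.coe_smul, LinearMap.add_apply,
    LinearMap.smul_apply, hU, hY, hE, hF, OspV.dAction, LinearMap.sub_apply,
    Module.End.mul_apply, Module.End.one_apply]

/-- Stability passes to $f=1-e$, then to $B$ and to the algebra it generates, which is all of
$\mathrm{End}_F(V)$. -/
theorem IsKacDIso.eq_top_of_stable (hgen : Algebra.adjoin F (B : Set (Module.End F V)) = ⊤)
    (hψ : IsKacDIso (endGrading 𝒱) B t ψ) (h1 : (1 : Module.End F V) ∈ B) (S : Submodule F V)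
    (hE : ∀ w ∈ S, (ψ (KacD.e F t) : Module.End F V) w ∈ S)
    (hU : ∀ w ∈ S, (ψ (KacD.u F t) : Module.End F V) w ∈ S)
    (hY : ∀ w ∈ S, (ψ (KacD.v F t) : Module.End F V) w ∈ S) (hS : S ≠ ⊥) : S = ⊤ := by
  have hF : ∀ w ∈ S, (ψ (KacD.f F t) : Module.End F V) w ∈ S := fun w hw => by
    have h := LinearMap.congr_fun (hψ.e_add_f h1) w
    rw [LinearMap.add_apply, Module.End.one_apply, ← eq_sub_iff_add_eq'] at h
    rw [h]
    exact S.sub_mem hw (hE w hw)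
  have hB : ∀ a ∈ B, ∀ w ∈ S, a w ∈ S := fun a ha w hw => by
    obtain ⟨x, hx⟩ : ∃ x, ψ x = ⟨a, ha⟩ := ψ.surjective _
    have : a = (ψ x : Module.End F V) := by rw [hx]
    rw [this, KacD.eq_sum F t x]
    simp only [map_add, map_smul, Submodule.coe_add, Submodule.coe_smul, LinearMap.add_apply,
      LinearMap.smul_apply]
    exact S.add_mem (S.add_mem (S.add_mem (S.smul_mem _ (hE w hw)) (S.smul_mem _ (hF w hw)))
      (S.smul_mem _ (hU w hw))) (S.smul_mem _ (hY w hw))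
  have hall : ∀ f : Module.End F V, ∀ w ∈ S, f w ∈ S := fun f => by
    have hf : f ∈ Algebra.adjoin F (B : Set (Module.End F V)) := hgen ▸ Algebra.mem_top
    induction hf using Algebra.adjoin_induction with
    | mem a ha => exact hB a ha
    | algebraMap c => exact fun w hw => S.smul_mem c hw
    | add f g _ _ hf hg => exact fun w hw => S.add_mem (hf w hw) (hg w hw)
    | mul f g _ _ hf hg => exact fun w hw => hf _ (hg w hw)
  obtain ⟨x, hx, hx0⟩ := S.exists_mem_ne_zero_of_ne_bot hS
  rw [eq_top_iff]
  intro y _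
  obtain ⟨l, hl⟩ := Module.Projective.exists_dual_ne_zero F hx0
  -- This rank-one operator carries $x$ to the arbitrary vector $y$.
  have := hall (LinearMap.smulRight l ((l x)⁻¹ • y)) x hx
  simpa [smul_smul, hl] using this

end KacDIso

/-! ### The classification, split by the parity of $m$. -/

theorem mainTheorem6 {F V : Type*} [Field F] [IsAlgClosed F] [CharZero F]
    [AddCommGroup V] [Module F V] [FiniteDimensional F V] [Nontrivial V]
    (𝒱 : ZMod 2 → Submodule F V) [DirectSum.Decomposition 𝒱]
    (t : F) (ht0 : t ≠ 0) (ht1 : t ≠ 1) (ht2 : t ≠ -1)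
    (B : Submodule F (Module.End F V))
    (hB : IsUnitalJordanSubalgebra (endGrading 𝒱) B)
    (ψ : KacD F t ≃ₗ[F] B) (hψ : IsKacDIso (endGrading 𝒱) B t ψ)
    (hgen : Algebra.adjoin F (B : Set (Module.End F V)) = ⊤) :
    ∃ m : ℕ, 1 ≤ m ∧ (t = -((m : F) / (m + 1)) ∨ t = -(((m : F) + 1) / m)) ∧
      ((Even m ∧ ∃ φ : V ≃ₗ[F] OspV F m,
          IsHomogeneousEquiv 𝒱 (OspV.grading F m) φ ∧
          (∀ a v, φ ((ψ a : Module.End F V) v) = OspV.dAction F m t a (φ v)) ∧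
          ∀ b, OspV.IsInvariantForm F m b →
            IsSuperform (OspV.grading F m) b ∧
            ∃ star, IsAssociatedSuperinvolution (OspV.grading F m) b star ∧
              ∀ c ∈ B, φ.conj c ∈ hermitianPart star) ∨
       (Odd m ∧ ∃ φ : V ≃ₗ[F] OspV F m,
          IsHomogeneousEquiv 𝒱 (opGrading (OspV.grading F m)) φ ∧
          (∀ a v, φ ((ψ a : Module.End F V) v) = OspV.dAction F m t a (φ v)) ∧
          ∀ b, OspV.IsInvariantForm F m b →
            IsSuperform (opGrading (OspV.grading F m)) (OspV.opForm F m b) ∧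
            ∃ star, IsAssociatedSuperinvolution (opGrading (OspV.grading F m))
                (OspV.opForm F m b) star ∧
              ∀ c ∈ B, φ.conj c ∈ hermitianPart star)) := by
  have h1 := hB.one_mem
  obtain ⟨m, hm, htm, φ, ⟨ε, hφ⟩, hU, hY⟩ := (hψ.isKacDTriple h1).exists_equiv ht0 ht2
    (hψ.eq_top_of_stable hgen h1)
  have hact := hψ.apply_eq_dAction h1 ht1 hU hY
  have hconj : ∀ c ∈ B, ∃ a, φ.conj c = OspV.dAction F m t a := fun c hc => by
    refine ⟨ψ.symm ⟨c, hc⟩, LinearMap.ext fun w => ?_⟩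
    have := hact (ψ.symm ⟨c, hc⟩) (φ.symm w)
    rw [ψ.apply_symm_apply, φ.apply_symm_apply] at this
    exact this
  refine ⟨m, hm, htm, ?_⟩
  rcases Nat.even_or_odd m with hm | hm
  · refine Or.inl ⟨hm, φ, ⟨ε, hφ⟩, hact, fun b hb => ?_⟩
    have hS := OspV.isParityOp_parityOp F m
    have hsf := hb.isSuperform hm
    obtain ⟨star, hstar⟩ := hS.exists_associated hsf
    refine ⟨hsf, star, hstar, fun c hc => ?_⟩
    obtain ⟨a, ha⟩ := hconj c hc
    rw [ha]
    exact OspV.dAction_mem_hermitianPart hS hsf hstar (OspV.rhoX_mem F m) (OspV.rhoY_mem F m)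
      (fun _ _ hv w => hb.supersymm_x.apply hv w)
      (fun _ _ hv w => hb.supersymm_y.apply hv w) t a
  -- The same bijection serves for $V(m)^{op}$; only its degree changes by one.
  · refine Or.inr ⟨hm, φ, ⟨ε + 1, fun i v hv => ?_⟩, hact, fun b hb => ?_⟩
    · have h2 : (1 + 1 : ZMod 2) = 0 := rfl
      rw [opGrading, add_assoc, add_assoc, h2, add_zero]
      exact hφ i v hv
    have hS := OspV.isParityOp_neg_parityOp F m
    have hsf := hb.isSuperform_opForm hm
    obtain ⟨star, hstar⟩ := hS.exists_associated hsf
    refine ⟨hsf, star, hstar, fun c hc => ?_⟩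
    obtain ⟨a, ha⟩ := hconj c hc
    rw [ha]
    exact OspV.dAction_mem_hermitianPart hS hsf hstar
      (mem_endGrading_opGrading (OspV.rhoX_mem F m))
      (mem_endGrading_opGrading (OspV.rhoY_mem F m))
      (fun _ _ hv _ => hb.supersymm_x.opForm_adjoint (OspV.rhoX_mem F m) hv)
      (fun _ _ hv _ => hb.supersymm_y.opForm_adjoint (OspV.rhoY_mem F m) hv) t a
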